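/- Let $n\ge 1$, let $m_1,\dots,m_n\ge 1$ be integers, and put $K=m_1+\cdots+m_n$. For $|x_i|<1$ let $$Li_{m_1,\dots,m_n}(x_1,\dots,x_n)=\sum_{0<k_1<\cdots<k_n}\frac{x_1^{k_1}\cdots x_n^{k_n}}{k_1^{m_1}\cdots k_n^{m_n}},$$ and let $D_n=\{\mathbf x\in\mathbb C^n: |x_j-\tfrac12|<\tfrac12,\ 1\le j\le n\}$. *Indices.* Let $\mathfrak S(m_1,\dots,m_n)$ be the set of $\mathbf i=(i_1,\dots,i_n)\in\mathbb Z^n$ with $0\le i_t\le m_t$; put $|\mathbf i|=i_1+\cdots+i_n$, and write $\mathbf j\prec\mathbf i$ if $j_t\le i_t$ for all $t$. The depth of $\mathbf i$ is the number of its nonzero components. If $\mathbf i$ has depth $k$ and its nonzero components are at the positions $\tau_1<\cdots<\tau_k$, put $\tau_{k+1}=n+1$ and $\mathbf x(\mathbf i)=(y_1,\dots,y_k)$ with $y_l=\prod_{\tau_l\le\alpha<\tau_{l+1}}x_\alpha$. Let $\mathfrak S^K(m_1,\dots,m_n)$ be the set of $K$-tuples $\vec{\jmath}=(\mathbf j_1,\dots,\mathbf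 j_K)$ of elements of $\mathfrak S(m_1,\dots,m_n)$ with $|\mathbf j_t|=t$ and $\mathbf j_1\prec\cdots\prec\mathbf j_K=(m_1,\dots,m_n)$. Put $\mathbf j_0=\mathbf 0$. *Transposition functions.* Given $\vec{\jmath}$ and $1\le r\le K$, write $\mathbf j_r=(t_1,\dots,t_n)$, and let $s$ be the position such that $\mathbf j_r$ is obtained from $\mathbf j_{r-1}$ by increasing the $s$-th component by $1$. If $t_s=1$ and some $t_b$ with $b>s$ is nonzero, let $a$ be the least such $b$ and let $\sigma$ be the transposition exchanging $s$ and $a$; otherwise let $\sigma=\mathrm{id}$. Put $T^r_0=\mathrm{id}$ and $T^r_1(i_1,\dots,i_n)=(i_{\sigma(1)},\dots,i_{\sigma(n)})$. *The 1-forms.* Let $\delta=(\delta_1,\dots,\delta_K)\in\{0,1\}^K$. Let $l$ be the depth of $\mathbf j_r$, let $s$ be the $\lambda$-th of the nonzero positions of $\mathbf j_r$ in increasing order, and let $\mathbf y=(y_1,\dots,y_l)=\mathbf x(\mathbf i)$, where $\mathbf i$ is obtained from $\mathbf j_r$ by applying first $T^{r+1}_{\delta_{r+1}}$, then $T^{r+2}_{\delta_{r+2}}$,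 and so on, and $T^K_{\delta_K}$ last (so $\mathbf i=\mathbf j_K$ and $\mathbf y=\mathbf x$ if $r=K$). Define the 1-form on $D_n$ in the variable $\mathbf x$ $$w^{r,\delta_r}_{\vec{\jmath}}(\mathbf y)=\begin{cases}0&\text{if }t_s>1,\ \delta_r=1,\\ dy_\lambda/y_\lambda&\text{if }t_s>1,\ \delta_r=0,\\ dy_\lambda/(1-y_\lambda)&\text{if }t_s=1,\ \delta_r=0,\\ dy_\lambda/(y_\lambda(y_\lambda-1))&\text{if }\lambda<l,\ t_s=1,\ \delta_r=1,\\ 0&\text{if }\lambda=l,\ t_s=1,\ \delta_r=1.\end{cases}$$ *Iterated integrals.* For a piecewise continuously differentiable path $\gamma:[0,1]\to\mathbb C^n$ and 1-forms with $\gamma^*w_i=f_i(t)\,dt$, let $\int_\gamma w_1\cdots w_r=\int_{0\le t_1\le\cdots\le t_r\le 1}f_1(t_1)\cdots f_r(t_r)\,dt_1\cdots dt_r$. **Proposition.** Let $\mathbf x\in D_n$. Then the series $Li_{m_1,\dots,m_n}(\mathbf x)$ converges absolutely. For every complex $\varepsilon$ with $|\varepsilon-\frac12|<\frac12$ let $\gamma_\varepsilon$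 be any piecewise continuously differentiable path from $(\varepsilon,\dots,\varepsilon)$ to $\mathbf x$ lying entirely in $D_n$. Then, as $\varepsilon\to0$ inside the disc $|\varepsilon-\frac12|<\frac12$, $$Li_{m_1,\dots,m_n}(\mathbf x)=\lim_{\varepsilon\to0}\ \sum_{\delta\in\{0,1\}^K}\ \sum_{\vec{\jmath}\in\mathfrak S^K(m_1,\dots,m_n)}\int_{\gamma_\varepsilon}w^{1,\delta_1}_{\vec{\jmath}}\,w^{2,\delta_2}_{\vec{\jmath}}\cdots w^{K,\delta_K}_{\vec{\jmath}}.$$ -/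

import Mathlib

open Set Filter Topology

noncomputable section

namespace MultiPolylog

/-! ### Multiple polylogarithms -/

/-- The summation range `0 < k₁ < k₂ < ⋯ < kₙ`. -/
abbrev SumRange (n : ℕ) : Type := {k : Fin n → ℕ // StrictMono k ∧ ∀ i, 0 < k i}

/-- The general term `x₁^{k₁} ⋯ xₙ^{kₙ} / (k₁^{m₁} ⋯ kₙ^{mₙ})`. -/
def liTerm {n : ℕ} (m : Fin n → ℕ) (x : Fin n → ℂ) (k : SumRange n) : ℂ :=
  ∏ i, x i ^ k.1 i / (k.1 i : ℂ) ^ m i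

/-- The multiple polylogarithm `Li_{m₁,…,mₙ}(x₁,…,xₙ)`. -/
def Li {n : ℕ} (m : Fin n → ℕ) (x : Fin n → ℂ) : ℂ :=
  ∑' k : SumRange n, liTerm m x k

/-- The polydisc `Dₙ = {x : |x_j - 1/2| < 1/2 for all j}`. -/
def polydisc (n : ℕ) : Set (Fin n → ℂ) :=
  {x | ∀ j, ‖x j - 1 / 2‖ < 1 / 2}

/-- The point `(ε, …, ε)` of `ℂⁿ`. -/
def diagPt (n : ℕ) (ε : ℂ) : Fin n → ℂ := fun _ => ε

/-! ### Indices, depth and the points `x(i)` -/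

/-- The index set `𝔖(m₁,…,mₙ) = {i : 0 ≤ i_t ≤ m_t for all t}`. The partial ordering `≺` on it
is the componentwise order of `Fin n → ℕ`. -/
def indexSet {n : ℕ} (m : Fin n → ℕ) : Finset (Fin n → ℕ) := Finset.Iic m

/-- The set of positions at which an index is nonzero. -/
def support {n : ℕ} (i : Fin n → ℕ) : Finset (Fin n) :=
  Finset.univ.filter (fun p => i p ≠ 0)

/-- The depth of an index, the number of its nonzero components. -/
def depth {n : ℕ} (i : Fin n → ℕ) : ℕ := (support i).card

/-- The positions `τ₁ < ⋯ < τ_k` of the nonzero components of an index of depth `k`, followed by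
the convention `τ_{k+1} = n + 1`. Everything is counted from zero: `nonzeroPos i l` is `τ_{l+1}`,
as an element of `{0, …, n-1}`, and equals `n` for `l ≥ k`. -/
def nonzeroPos {n : ℕ} (i : Fin n → ℕ) (l : ℕ) : ℕ :=
  (((support i).sort (· ≤ ·)).map Fin.val).getD l n

/-- The `l`-th component (counted from zero, `l < depth i`) of the point
`x(i) = (y₁, …, y_k) ∈ ℂᵏ`, namely `∏ x_α` over `τ_{l+1} ≤ α < τ_{l+2}`. -/
def yCoord {n : ℕ} (i : Fin n → ℕ) (l : ℕ) (x : Fin n → ℂ) : ℂ :=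
  ∏ α ∈ Finset.univ.filter
    (fun α : Fin n => nonzeroPos i l ≤ α.val ∧ α.val < nonzeroPos i (l + 1)), x α

/-! ### Vector indices and transpositions -/

/-- The weight `K = m₁ + ⋯ + mₙ`. -/
abbrev weight {n : ℕ} (m : Fin n → ℕ) : ℕ := ∑ i, m i

/-- The set `𝔖^K(m₁,…,mₙ)` of vector indices `(j₁, …, j_K)`: `|j_t| = t` and
`j₁ ≺ ⋯ ≺ j_K = (m₁, …, mₙ)`. The entry `j_t` is the value at `t - 1 : Fin K`. -/
def vectorIndices {n : ℕ} (m : Fin n → ℕ) : Finset (Fin (weight m) → Fin n → ℕ) :=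
  open Classical in
  (Fintype.piFinset fun _ => indexSet m).filter fun j =>
    (∀ t, ∑ i, j t i = t.val + 1) ∧ Monotone j ∧ ∀ t, t.val + 1 = weight m → j t = m

/-- The predecessor `j_{r-1}` of `j_r`, with `j₀ = 0`. -/
def prevIndex {n K : ℕ} (j : Fin K → Fin n → ℕ) (r : Fin K) : Fin n → ℕ :=
  if r.val = 0 then 0 else j ⟨r.val - 1, lt_of_le_of_lt (Nat.sub_le _ _) r.isLt⟩

/-- The position `s` with `j_r = j_{r-1} + u_s`, where `u_s` is the `s`-th unit vector
(it exists and is unique for vector indices). -/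
def stepPos {n K : ℕ} [NeZero n] (j : Fin K → Fin n → ℕ) (r : Fin K) : Fin n :=
  Classical.epsilon fun s => j r = prevIndex j r + Pi.single s 1

/-- The positions to the right of `s` at which an index is nonzero. -/
def laterSupport {n : ℕ} (i : Fin n → ℕ) (s : Fin n) : Finset (Fin n) :=
  (support i).filter (fun a => s < a)

/-- The permutation `σ` attached to the `r`-th step `j_r = j_{r-1} + u_s`: if the `s`-th component
of `j_r` is `1` and `j_r` has a nonzero component to the right of `s`, the first of them being at
`a`, then `σ` exchanges `s` and `a`; otherwise `σ` is the identity. -/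
def stepPerm {n K : ℕ} [NeZero n] (j : Fin K → Fin n → ℕ) (r : Fin K) : Equiv.Perm (Fin n) :=
  if h : j r (stepPos j r) = 1 ∧ (laterSupport (j r) (stepPos j r)).Nonempty then
    Equiv.swap (stepPos j r) ((laterSupport (j r) (stepPos j r)).min' h.2)
  else 1

/-- The transposition function `T^r_δ`: the identity for `δ = 0`, and
`(i₁, …, iₙ) ↦ (i_{σ(1)}, …, i_{σ(n)})` for `δ = 1`. -/
def transposition {n K : ℕ} [NeZero n] (j : Fin K → Fin n → ℕ) (r : Fin K) (δ : Fin 2)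
    (i : Fin n → ℕ) : Fin n → ℕ :=
  if δ = 0 then i else fun p => i (stepPerm j r p)

/-- The index obtained from `j_r` by applying first `T^{r+1}`, then `T^{r+2}`, and so on, and
`T^K` last, each `T^t` being taken with the subscript `δ_t`. For `r = K` it is `j_K`. -/
def transposedIndex {n K : ℕ} [NeZero n] (j : Fin K → Fin n → ℕ) (δ : Fin K → Fin 2)
    (r : Fin K) : Fin n → ℕ :=
  ((List.finRange K).filter (fun t => r < t)).foldl (fun i t => transposition j t (δ t) i) (j r)

/-- The rank `λ` of the position `s` among the nonzero positions of `j_r`, counted from zero. -/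
def stepRank {n K : ℕ} [NeZero n] (j : Fin K → Fin n → ℕ) (r : Fin K) : ℕ :=
  ((support (j r)).filter (fun p => p < stepPos j r)).card

/-! ### The 1-forms -/

/-- A `ℂ`-valued 1-form on `ℂⁿ`. -/
abbrev OneForm (n : ℕ) : Type := (Fin n → ℂ) → ((Fin n → ℂ) →L[ℂ] ℂ)

/-- The 1-form `w^{r,δ_r}_j(y)`, where `y = x(i)` for the index `i` obtained from `j_r` by the
transposition functions; it is regarded as a 1-form in the variable `x`, so that `dy_λ` is the
differential of `x ↦ y_λ(x)`. -/
def oneForm {n K : ℕ} [NeZero n] (j : Fin K → Fin n → ℕ) (δ : Fin K → Fin 2) (r : Fin K) :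
    OneForm n := fun x =>
  let y : (Fin n → ℂ) → ℂ := yCoord (transposedIndex j δ r) (stepRank j r)
  if 1 < j r (stepPos j r) then
    if δ r = 0 then (1 / y x) • fderiv ℂ y x else 0
  else
    if δ r = 0 then (1 / (1 - y x)) • fderiv ℂ y x
    else if stepRank j r + 1 < depth (j r) then (1 / (y x * (y x - 1))) • fderiv ℂ y x
    else 0

/-! ### Iterated path integrals -/

/-- The iterated integral `∫_a^b f₁(t)dt ⋯ f_r(t)dt`, equal to `1` for `r = 0` and to
`∫_a^b (∫_a^t f₁(τ)dτ ⋯ f_{r-1}(τ)dτ) f_r(t) dt` otherwise. -/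
def iteratedIntegral (a : ℝ) : (r : ℕ) → (Fin r → ℝ → ℂ) → ℝ → ℂ
  | 0, _, _ => 1
  | r + 1, f, b => ∫ t in a..b, iteratedIntegral a r (fun i => f i.castSucc) t * f (Fin.last r) t

/-- The iterated path integral `∫_γ w₁ ⋯ w_r` along a path `γ : [0,1] → ℂⁿ`. -/
def iteratedPathIntegral {n r : ℕ} (γ : ℝ → Fin n → ℂ) (w : Fin r → OneForm n) : ℂ :=
  iteratedIntegral 0 r (fun i t => w i (γ t) (deriv γ t)) 1

/-- `γ` is continuous on `[0,1]` and continuously differentiable on each closed interval of some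
finite partition `0 = t₀ < t₁ < ⋯ < t_N = 1`. -/
def IsPiecewiseC1 {n : ℕ} (γ : ℝ → Fin n → ℂ) : Prop :=
  ContinuousOn γ (Icc 0 1) ∧
    ∃ (N : ℕ) (t : Fin (N + 1) → ℝ), StrictMono t ∧ t 0 = 0 ∧ t (Fin.last N) = 1 ∧
      ∀ i : Fin N, ContDiffOn ℝ 1 γ (Icc (t i.castSucc) (t i.succ))

/-- `γ` is a piecewise continuously differentiable path from `p` to `q` which lies entirely
in `D`. -/
def IsPathIn {n : ℕ} (D : Set (Fin n → ℂ)) (p q : Fin n → ℂ) (γ : ℝ → Fin n → ℂ) : Prop :=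
  IsPiecewiseC1 γ ∧ γ 0 = p ∧ γ 1 = q ∧ ∀ t ∈ Icc (0 : ℝ) 1, γ t ∈ D

/-- The integral along `γ` of the sum, over all `δ ∈ {0,1}^K` and all vector indices
`j ∈ 𝔖^K(m₁,…,mₙ)`, of the words `w^{1,δ₁}_j ⋯ w^{K,δ_K}_j`. -/
def polylogPathIntegral {n : ℕ} [NeZero n] (m : Fin n → ℕ) (γ : ℝ → Fin n → ℂ) : ℂ :=
  ∑ δ : Fin (weight m) → Fin 2, ∑ j ∈ vectorIndices m, iteratedPathIntegral γ (oneForm j δ)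

end MultiPolylog

end

noncomputable section

namespace MultiPolylog

/-! ### Words and the flat connection attached to them

A word of length `K` is given by a sequence `f : ℕ → A`: its letters are `f 1, …, f K`, preceded by
the start letter `f 0` and followed by the end letter `f (K + 1)`. -/

/-! Put `a_p = ∏_{α ≥ p} 1/x_α`, with positions counted from 0, so that `a_n = 1`. Up to the sign
`(-1)^depth`, the polylogarithm of an index should be the iterated integral `I(0; a_{τ₁}, 0, …, 0,
a_{τ₂}, 0, …; 1)`. The differential of such an integral in its letters is the sum over `i` of the
integral without `a_i`, times `d log (a_i - a_{i+1}) - d log (a_i - a_{i-1})`. Read as a system for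
unknown functions of words, this is integrable: the curvature vanishes by the Arnold relations among
the forms `d log (a - b)`. So on the convex domain there is, for every base point `p`, a solution
equal to 1 on the empty word and vanishing at `p` on all others (`IsArnold.hasFDerivAt_wordFun`).

On the words of indices the system becomes the one of the proposition (`hasFDerivAt_indexFun`):
removing a letter either lowers a component by one (`δ = 0`), or removes the nonzero letter
following a component 1, which yields a transposed index (`δ = 1`). Integrating along a path and
peeling off the last form each time produces exactly the sum over `δ` and the vector indices
(`sum_iteratedIntegral_eq`). Hence that sum is the solution based at `γ 0`, evaluated at `γ 1`,
whatever the path (`polylogPathIntegral_eq`).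

For the limit the solution is followed along two straight legs: from `(ε, …, ε)` to `x` with its
last coordinate replaced by `ε`, then to `x`. On the first leg every solution of positive weight is
`O(ε log^K)`, because the innermost form has a factor `ε` and every integration costs one logarithm
(`norm_indexFun_legPath_le`). On the second leg only the last variable moves, and the solution and
the series satisfy the same ordinary differential equations (`hasDerivAt_truncLi`,
`hasDerivAt_indexFun_truncIdx`), so their initial difference grows by at most another power of the
logarithm (`norm_truncLi_sub_indexFun_le`). The error `ε log^{2K}` tends to 0. -/

/-- The relabelling of positions which omits the position `i + 1`. -/
def skip (i k : ℕ) : ℕ := if k ≤ i then k else k + 1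

/-- The same two letters are removed in either order; the later one moves down by one place once the
earlier one is gone. -/
lemma skip_comp_skip {i j : ℕ} (h : i ≤ j) : skip i ∘ skip j = skip (j + 1) ∘ skip i := by
  funext k
  simp only [skip, Function.comp]
  split_ifs <;> omega

/-- Pairs of successive removals are matched: for `i ≤ j`, removing `i` then `j` and removing `j +
1` then `i` delete the same two letters. The curvature can then be checked one unordered pair at a
time. -/
lemma sum_range_succ_sum_range {M : Type*} [AddCommMonoid M] (F : ℕ → ℕ → M) (N : ℕ) :
    ∑ i ∈ Finset.range (N + 1), ∑ j ∈ Finset.range N, F i j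
      = ∑ j ∈ Finset.range N, ∑ i ∈ Finset.range (j + 1), (F i j + F (j + 1) i) := by
  induction N with
  | zero => simp
  | succ N ih =>
    simp only [Finset.sum_range_succ _ N] at ih ⊢
    rw [Finset.sum_range_succ, Finset.sum_range_succ _ N, ← ih]
    simp only [Finset.sum_add_distrib]
    abel

section Flat

variable {A : Type*} {n : ℕ} (η : A → A → OneForm n)

/-- The coefficient of the removal of the letter at position `i + 1`. -/
def removalForm (f : ℕ → A) (i : ℕ) : OneForm n := fun x =>
  η (f (i + 1)) (f (i + 2)) x - η (f (i + 1)) (f i) x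

/-- The connection form applied to a family of functions on words of length `K`. -/
def wordForm (K : ℕ) (Φ : (ℕ → A) → (Fin n → ℂ) → ℂ) (f : ℕ → A) : OneForm n := fun x =>
  ∑ i ∈ Finset.range (K + 1), Φ (f ∘ skip i) x • removalForm η f i x

/-- The flat section of the connection which is `1` on the empty word and vanishes at `p` on all
other words. -/
def wordFun (p : Fin n → ℂ) : ℕ → (ℕ → A) → (Fin n → ℂ) → ℂ
  | 0, _ => fun _ => 1
  | K + 1, f => fun x => curveIntegral (wordForm η K (wordFun p K) f) (Path.segment p x)

@[simp] lemma wordFun_zero (p : Fin n → ℂ) (f : ℕ → A) (x : Fin n → ℂ) :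
    wordFun η p 0 f x = 1 := rfl

@[simp] lemma wordFun_base (p : Fin n → ℂ) (K : ℕ) (f : ℕ → A) :
    wordFun η p (K + 1) f p = 0 := by
  simp [wordFun]

/-- The derivative of `wordFun`. -/
def wordDeriv (p : Fin n → ℂ) : ℕ → (ℕ → A) → OneForm n
  | 0, _ => 0
  | K + 1, f => wordForm η K (wordFun η p K) f

/-- A family of 1-forms `η a b = d log (a - b)`: symmetric, closed, and subject to the Arnold
relations. -/
structure IsArnold (D : Set (Fin n → ℂ)) : Prop where
  symm : ∀ a b, ∀ x ∈ D, η a b x = η b a x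
  closed : ∀ a b, ∀ x ∈ D, ∃ η' : (Fin n → ℂ) →L[ℂ] (Fin n → ℂ) →L[ℂ] ℂ,
    HasFDerivAt (η a b) η' x ∧ ∀ u v, η' u v = η' v u
  arnold : ∀ a b c, ∀ x ∈ D, ∀ u v,
    η a b x u * η b c x v - η a b x v * η b c x u + (η b c x u * η c a x v - η b c x v * η c a x u)
      + (η c a x u * η a b x v - η c a x v * η a b x u) = 0

variable {η}

/-- The curvature contributed by one pair of letters. If they are not adjacent, removing one does
not alter the form of the other. If they are adjacent, two Arnold relations are needed: one for the
pair with its right neighbour, one with its left. -/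
lemma IsArnold.removal_symm {D : Set (Fin n → ℂ)} (h : IsArnold η D) {x : Fin n → ℂ} (hx : x ∈ D)
    (f : ℕ → A) {i j : ℕ} (hij : i ≤ j) (u v : Fin n → ℂ) :
    removalForm η (f ∘ skip i) j x u * removalForm η f i x v
        + removalForm η (f ∘ skip (j + 1)) i x u * removalForm η f (j + 1) x v
      = removalForm η (f ∘ skip i) j x v * removalForm η f i x u
        + removalForm η (f ∘ skip (j + 1)) i x v * removalForm η f (j + 1) x u := by
  rcases hij.lt_or_eq with hlt | rfl
  · have h1 : removalForm η (f ∘ skip i) j = removalForm η f (j + 1) := by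
      unfold removalForm skip
      simp only [Function.comp]
      rw [if_neg (by omega), if_neg (by omega), if_neg (by omega)]
    have h2 : removalForm η (f ∘ skip (j + 1)) i = removalForm η f i := by
      unfold removalForm skip
      simp only [Function.comp]
      rw [if_pos (by omega), if_pos (by omega), if_pos (by omega)]
    rw [h1, h2]; ring
  · have e1 : skip i i = i := by simp [skip]
    have e2 : skip i (i + 1) = i + 2 := by simp [skip]
    have e3 : skip i (i + 2) = i + 3 := by simp [skip]
    have e4 : skip (i + 1) i = i := by simp [skip]
    have e5 : skip (i + 1) (i + 1) = i + 1 := by simp [skip]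
    have e6 : skip (i + 1) (i + 2) = i + 3 := by simp [skip]
    simp only [removalForm, Function.comp, e1, e2, e3, e4, e5, e6, sub_apply]
    have A1 := h.arnold (f (i+1)) (f (i+2)) (f (i+3)) x hx u v
    have A2 := h.arnold (f (i+1)) (f (i+2)) (f i) x hx u v
    rw [h.symm (f (i+3)) (f (i+1)) x hx] at A1
    rw [h.symm (f i) (f (i+1)) x hx] at A2
    rw [show i + 1 + 1 = i + 2 from rfl, show i + 1 + 2 = i + 3 from rfl, h.symm (f (i+2)) (f (i+1)) x hx]
    linear_combination (-1 : ℂ) * A1 + A2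

/-- As the removal forms are closed, only the terms `dΦ ∧ ω` remain. Inserting the equations at
length `K` turns them into a sum over pairs of removals, which cancels by `IsArnold.removal_symm`.
-/
lemma IsArnold.wordForm_closed {D : Set (Fin n → ℂ)} (h : IsArnold η D) {p : Fin n → ℂ} (K : ℕ)
    (hK : ∀ f, ∀ x ∈ D, HasFDerivAt (wordFun η p K f) (wordDeriv η p K f x) x) (f : ℕ → A) :
    ∀ x ∈ D, ∃ ω' : (Fin n → ℂ) →L[ℂ] (Fin n → ℂ) →L[ℂ] ℂ,
      HasFDerivAt (wordForm η K (wordFun η p K) f) ω' x ∧ ∀ u v, ω' u v = ω' v u := by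
  intro x hx
  have hr : ∀ i, ∃ η' : (Fin n → ℂ) →L[ℂ] (Fin n → ℂ) →L[ℂ] ℂ,
      HasFDerivAt (removalForm η f i) η' x ∧ ∀ u v, η' u v = η' v u := by
    intro i
    obtain ⟨a, ha, ha'⟩ := h.closed (f (i+1)) (f (i+2)) x hx
    obtain ⟨b, hb, hb'⟩ := h.closed (f (i+1)) (f i) x hx
    exact ⟨a - b, ha.sub hb, fun u v => by simp [ha' u v, hb' u v]⟩
  choose r hr hr' using hr
  refine ⟨_, HasFDerivAt.fun_sum fun i _ => (hK (f ∘ skip i) x hx).smul (hr i), fun u v => ?_⟩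
  simp only [sum_apply, add_apply,
    smul_apply, ContinuousLinearMap.smulRight_apply, Finset.sum_add_distrib,
    smul_eq_mul]
  congr 1
  · exact Finset.sum_congr rfl fun i _ => by rw [hr']
  · cases K with
    | zero => simp [wordDeriv]
    | succ K =>
      simp only [wordDeriv, wordForm, sum_apply,
        smul_apply, Finset.sum_mul, smul_eq_mul]
      rw [sum_range_succ_sum_range, sum_range_succ_sum_range]
      refine Finset.sum_congr rfl fun j _ => Finset.sum_congr rfl fun i hi => ?_
      have hij : i ≤ j := by simpa [Nat.lt_succ_iff] using hi
      rw [Function.comp_assoc f (skip i), skip_comp_skip hij, Function.comp_assoc f (skip (j+1))]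
      have := h.removal_symm hx f hij u v
      linear_combination (wordFun η p K (f ∘ skip (j+1) ∘ skip i) x) * this

/-- Poincaré lemma on a convex set, by induction on the length: the segment integral of a closed
form is a primitive of it. -/
theorem IsArnold.hasFDerivAt_wordFun {D : Set (Fin n → ℂ)} (h : IsArnold η D) (hD : IsOpen D)
    (hc : Convex ℝ D) {p : Fin n → ℂ} (hp : p ∈ D) (K : ℕ) :
    ∀ f, ∀ x ∈ D, HasFDerivAt (wordFun η p K f) (wordDeriv η p K f x) x := by
  induction K with
  | zero => exact fun f x _ => hasFDerivAt_const _ _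
  | succ K ih =>
    intro f x hx
    choose! ω' h1 h2 using h.wordForm_closed K ih f
    refine HasFDerivWithinAt.hasFDerivAt ?_ (hD.mem_nhds hx)
    exact hc.hasFDerivWithinAt_curveIntegral_segment_of_hasFDerivWithinAt_symmetric
      (dω := fun x => (ω' x).restrictScalars ℝ)
      (fun y hy => ((h1 y hy).restrictScalars ℝ).hasFDerivWithinAt)
      (fun y hy u _ v _ => h2 y hy u v) hp hx

end Flat

/-! ### The letters of the words -/

section Polydisc
variable {n : ℕ}

lemma isOpen_polydisc : IsOpen (polydisc n) := by
  simp only [polydisc, ofPred_forall]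
  exact isOpen_iInter_of_finite fun j =>
    isOpen_lt (by fun_prop) continuous_const

lemma convex_polydisc : Convex ℝ (polydisc n) := by
  have : polydisc n = Set.pi univ fun _ => Metric.ball (1 / 2 : ℂ) (1 / 2) := by
    ext x; simp [polydisc, dist_eq_norm]
  rw [this]
  exact convex_pi fun _ _ => convex_ball _ _

variable {x : Fin n → ℂ} (hx : x ∈ polydisc n)
include hx

lemma re_pos_of_mem_polydisc (j : Fin n) : 0 < (x j).re := by
  have h1 := (Complex.abs_re_le_norm (x j - 1 / 2)).trans_lt (hx j)
  have h2 := (abs_lt.1 h1).1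
  norm_num at h2
  exact h2

lemma norm_lt_one_of_mem_polydisc (j : Fin n) : ‖x j‖ < 1 := by
  have := norm_add_le (x j - 1 / 2) (1 / 2)
  rw [sub_add_cancel] at this
  have h := hx j
  have h2 : ‖(1 / 2 : ℂ)‖ = 1 / 2 := by norm_num
  linarith

lemma ne_zero_of_mem_polydisc (j : Fin n) : x j ≠ 0 := fun h => by
  simpa [h] using re_pos_of_mem_polydisc hx j

lemma norm_prod_lt_one {S : Finset (Fin n)} (hS : S.Nonempty) : ‖∏ α ∈ S, x α‖ < 1 := by
  rw [norm_prod]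
  calc ∏ α ∈ S, ‖x α‖ < ∏ _α ∈ S, 1 := Finset.prod_lt_prod_of_nonempty
        (fun α _ => norm_pos_iff.2 (ne_zero_of_mem_polydisc hx α))
        (fun α _ => norm_lt_one_of_mem_polydisc hx α) hS
    _ = 1 := by simp

end Polydisc

section Letters
variable {n : ℕ}

/-- The value of a letter: `none` stands for `0` and `some p` for `∏_{α ≥ p} 1 / x_α`. -/
def letter (n : ℕ) : Option ℕ → (Fin n → ℂ) → ℂ
  | none => fun _ => 0
  | some p => fun x => ∏ α ∈ Finset.univ.filter (fun α : Fin n => p ≤ α.val), (x α)⁻¹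

/-- The product `∏_{p ≤ α < q} x_α`. -/
def segProd (n p q : ℕ) (x : Fin n → ℂ) : ℂ :=
  ∏ α ∈ Finset.univ.filter (fun α : Fin n => p ≤ α.val ∧ α.val < q), x α

lemma letter_ne_zero {x : Fin n → ℂ} (hx : x ∈ polydisc n) (p : ℕ) : letter n (some p) x ≠ 0 :=
  Finset.prod_ne_zero_iff.2 fun α _ => inv_ne_zero (ne_zero_of_mem_polydisc hx α)

lemma segProd_ne_zero {x : Fin n → ℂ} (hx : x ∈ polydisc n) (p q : ℕ) : segProd n p q x ≠ 0 :=
  Finset.prod_ne_zero_iff.2 fun α _ => ne_zero_of_mem_polydisc hx α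

lemma norm_segProd_lt_one {x : Fin n → ℂ} (hx : x ∈ polydisc n) {p q : ℕ} (hp : p < n)
    (hpq : p < q) : ‖segProd n p q x‖ < 1 :=
  norm_prod_lt_one hx ⟨⟨p, hp⟩, by simp [hpq]⟩

lemma segProd_ne_one {x : Fin n → ℂ} (hx : x ∈ polydisc n) {p q : ℕ} (hp : p < n)
    (hpq : p < q) : segProd n p q x ≠ 1 := fun h => by
  simpa [h] using norm_segProd_lt_one hx hp hpq

lemma letter_eq_segProd_mul {x : Fin n → ℂ} (hx : x ∈ polydisc n) {p q : ℕ} (hpq : p ≤ q) :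
    letter n (some q) x = segProd n p q x * letter n (some p) x := by
  have h : Finset.univ.filter (fun α : Fin n => p ≤ α.val)
      = Finset.univ.filter (fun α : Fin n => p ≤ α.val ∧ α.val < q)
        ∪ Finset.univ.filter (fun α : Fin n => q ≤ α.val) := by
    ext α; simp only [Finset.mem_filter_univ, Finset.mem_union]; omega
  have hd : Disjoint (Finset.univ.filter (fun α : Fin n => p ≤ α.val ∧ α.val < q))
      (Finset.univ.filter (fun α : Fin n => q ≤ α.val)) := by
    rw [Finset.disjoint_filter]; intros; omega
  simp only [letter, segProd, h, Finset.prod_union hd, Finset.prod_inv_distrib]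
  rw [← mul_assoc, mul_inv_cancel₀, one_mul]
  exact segProd_ne_zero hx p q

lemma contDiffAt_letter {x : Fin n → ℂ} (hx : x ∈ polydisc n) (a : Option ℕ) :
    ContDiffAt ℂ 2 (letter n a) x := by
  cases a with
  | none => exact contDiffAt_const
  | some p =>
    exact contDiffAt_prod fun α _ =>
      (contDiff_apply ℂ ℂ α).contDiffAt.inv (ne_zero_of_mem_polydisc hx α)

lemma differentiableAt_letter {x : Fin n → ℂ} (hx : x ∈ polydisc n) (a : Option ℕ) :
    DifferentiableAt ℂ (letter n a) x :=
  (contDiffAt_letter hx a).differentiableAt (by norm_num)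

lemma differentiable_segProd (p q : ℕ) : Differentiable ℂ (segProd n p q) := by
  unfold segProd
  fun_prop

/-- The ratio of the two letters is a product of coordinates, of modulus less than 1 unless the
product is empty. So letters agree everywhere on the polydisc or nowhere, and letting `dlogForm` be
0 on equal letters does not spoil its differentiability. -/
lemma letter_eq_of_le {x y : Fin n → ℂ} (hx : x ∈ polydisc n) (hy : y ∈ polydisc n) {p q : ℕ}
    (hpq : p ≤ q) (h : letter n (some p) x = letter n (some q) x) :
    letter n (some p) y = letter n (some q) y := by
  rw [letter_eq_segProd_mul hx hpq] at h
  rw [letter_eq_segProd_mul hy hpq]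
  have h1 : segProd n p q x = 1 := by
    have := letter_ne_zero hx p
    field_simp at h
    exact h.symm
  by_cases hp : p < n ∧ p < q
  · exact absurd h1 (segProd_ne_one hx hp.1 hp.2)
  · have : segProd n p q y = 1 := by
      unfold segProd
      rw [Finset.filter_false_of_mem, Finset.prod_empty]
      intro α _; have := α.2; omega
    rw [this, one_mul]

lemma letter_eq {x y : Fin n → ℂ} (hx : x ∈ polydisc n) (hy : y ∈ polydisc n) {a b : Option ℕ}
    (h : letter n a x = letter n b x) : letter n a y = letter n b y := by
  rcases a with _ | p <;> rcases b with _ | q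
  · rfl
  · exact absurd h.symm (letter_ne_zero hx q)
  · exact absurd h (letter_ne_zero hx p)
  · rcases le_total p q with hpq | hpq
    · exact letter_eq_of_le hx hy hpq h
    · exact (letter_eq_of_le hx hy hpq h.symm).symm

/-- The form `d log (a - b)`, which is `0` for equal letters. -/
def dlogForm (n : ℕ) (a b : Option ℕ) : OneForm n := fun x =>
  (letter n a x - letter n b x)⁻¹ • fderiv ℂ (fun y => letter n a y - letter n b y) x

lemma dlogForm_apply {x : Fin n → ℂ} (hx : x ∈ polydisc n) (a b : Option ℕ) (u : Fin n → ℂ) :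
    dlogForm n a b x u = (fderiv ℂ (letter n a) x u - fderiv ℂ (letter n b) x u) /
      (letter n a x - letter n b x) := by
  rw [dlogForm, fderiv_fun_sub (differentiableAt_letter hx a) (differentiableAt_letter hx b)]
  simp [div_eq_inv_mul]

lemma fderiv_letter_eq {x : Fin n → ℂ} (hx : x ∈ polydisc n) {a b : Option ℕ}
    (h : letter n a x = letter n b x) : fderiv ℂ (letter n a) x = fderiv ℂ (letter n b) x :=
  Filter.EventuallyEq.fderiv_eq <| by
    filter_upwards [isOpen_polydisc.mem_nhds hx] with y hy using letter_eq hx hy h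

/-- For equal letters the form vanishes near `x`. Otherwise, with `g = a - b`, the derivative of `dg
/ g` consists of the second derivative of `g` and a multiple of `dg ⊗ dg`, both symmetric. -/
lemma exists_hasFDerivAt_dlogForm {x : Fin n → ℂ} (hx : x ∈ polydisc n) (a b : Option ℕ) :
    ∃ η' : (Fin n → ℂ) →L[ℂ] (Fin n → ℂ) →L[ℂ] ℂ,
      HasFDerivAt (dlogForm n a b) η' x ∧ ∀ u v, η' u v = η' v u := by
  by_cases h : letter n a x = letter n b x
  · refine ⟨0, (hasFDerivAt_zero x).congr_of_eventuallyEq ?_, by simp⟩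
    filter_upwards [isOpen_polydisc.mem_nhds hx] with y hy
    ext1 u
    rw [dlogForm_apply hy, letter_eq hx hy h, sub_self, div_zero]
    rfl
  · set g : (Fin n → ℂ) → ℂ := fun y => letter n a y - letter n b y with hg
    have hg2 : ContDiffAt ℂ 2 g x := (contDiffAt_letter hx a).sub (contDiffAt_letter hx b)
    have hgx : g x ≠ 0 := sub_ne_zero.2 h
    have h1 : HasFDerivAt g (fderiv ℂ g x) x := (hg2.differentiableAt (by norm_num)).hasFDerivAt
    have h2 : HasFDerivAt (fderiv ℂ g) (fderiv ℂ (fderiv ℂ g) x) x :=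
      ((hg2.fderiv_right (m := 1) (by norm_num)).differentiableAt (by norm_num)).hasFDerivAt
    have hs : IsSymmSndFDerivAt ℂ g x := hg2.isSymmSndFDerivAt (by simp)
    have h3 : HasFDerivAt (fun y => (g y)⁻¹) _ x := (hasFDerivAt_inv hgx).comp x h1
    refine ⟨_, h3.smul h2, fun u v => ?_⟩
    simp only [add_apply, smul_apply, ContinuousLinearMap.smulRight_apply,
      ContinuousLinearMap.comp_apply, smul_eq_mul, hs u v, ContinuousLinearMap.toSpanSingleton_apply]
    ring

lemma isArnold_dlogForm : IsArnold (dlogForm n) (polydisc n) where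
  symm a b x hx := by
    ext1 u
    rw [dlogForm_apply hx, dlogForm_apply hx, ← neg_sub (letter n b x), ← neg_sub (fderiv ℂ (letter n b) x u),
      neg_div_neg_eq]
  closed a b x hx := exists_hasFDerivAt_dlogForm hx a b
  arnold a b c x hx u v := by
    simp only [dlogForm_apply hx]
    -- If two letters coincide, their form is 0 and the other two forms agree. For distinct letters
    -- the relation is the partial fraction identity for three differences with sum 0.
    by_cases hab : letter n a x = letter n b x
    · rw [hab, fderiv_letter_eq hx hab, ← neg_sub (letter n c x)]
      simp only [sub_self, div_zero, div_neg]
      ring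
    by_cases hbc : letter n b x = letter n c x
    · rw [hbc, fderiv_letter_eq hx hbc, ← neg_sub (letter n c x)]
      simp only [sub_self, div_zero, div_neg]
      ring
    by_cases hca : letter n c x = letter n a x
    · rw [hca, fderiv_letter_eq hx hca, ← neg_sub (letter n b x)]
      simp only [sub_self, div_zero, div_neg]
      ring
    have h1 := sub_ne_zero.2 hab
    have h2 := sub_ne_zero.2 hbc
    have h3 := sub_ne_zero.2 hca
    field_simp
    ring

section
variable {x : Fin n → ℂ} (hx : x ∈ polydisc n) {p q : ℕ} (hp : p < n) (hpq : p < q)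
include hx hpq

lemma fderiv_letter_eq_segProd (u : Fin n → ℂ) :
    fderiv ℂ (letter n (some q)) x u = segProd n p q x * fderiv ℂ (letter n (some p)) x u
      + letter n (some p) x * fderiv ℂ (segProd n p q) x u := by
  have : letter n (some q) =ᶠ[𝓝 x] fun y => segProd n p q y * letter n (some p) y := by
    filter_upwards [isOpen_polydisc.mem_nhds hx] with y hy using letter_eq_segProd_mul hy hpq.le
  rw [this.fderiv_eq, fderiv_fun_mul (differentiable_segProd p q x) (differentiableAt_letter hx _)]
  simp

/-- With `y = a_q / a_p` this is `d log a_q - d log a_p = d log y`. -/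
lemma dlogForm_none_sub :
    dlogForm n none (some q) x - dlogForm n none (some p) x
      = (1 / segProd n p q x) • fderiv ℂ (segProd n p q) x := by
  ext1 u
  have h0 := letter_ne_zero hx p
  have h1 := segProd_ne_zero hx p q
  have h2 : letter n none x = 0 := rfl
  have h3 : fderiv ℂ (letter n none) x = 0 := by
    rw [show letter n none = fun _ => (0 : ℂ) from rfl]; simp
  simp only [sub_apply, dlogForm_apply hx, fderiv_letter_eq_segProd hx hpq, h2, h3,
    letter_eq_segProd_mul hx hpq.le, smul_apply, zero_apply, smul_eq_mul]
  field_simp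
  ring

include hp

/-- With `y = a_q / a_p` this is `d log (a_p - a_q) - d log a_p = d log (1 - y)`. -/
lemma dlogForm_some_sub :
    dlogForm n (some p) (some q) x - dlogForm n (some p) none x
      = -((1 / (1 - segProd n p q x)) • fderiv ℂ (segProd n p q) x) := by
  ext1 u
  have h0 := letter_ne_zero hx p
  have h1 : 1 - segProd n p q x ≠ 0 := sub_ne_zero.2 (segProd_ne_one hx hp hpq).symm
  have h2 : letter n none x = 0 := rfl
  have h3 : fderiv ℂ (letter n none) x = 0 := by
    rw [show letter n none = fun _ => (0 : ℂ) from rfl]; simp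
  have h4 : letter n (some p) x - segProd n p q x * letter n (some p) x
    = letter n (some p) x * (1 - segProd n p q x) := by ring
  simp only [sub_apply, dlogForm_apply hx, fderiv_letter_eq_segProd hx hpq, h2, h3,
    letter_eq_segProd_mul hx hpq.le, smul_apply, zero_apply, smul_eq_mul, neg_apply, h4]
  field_simp
  ring

/-- With `y = a_q / a_p` this is `d log a_q - d log (a_q - a_p) = -d log (1 - 1/y)`. -/
lemma dlogForm_next_sub :
    dlogForm n (some q) none x - dlogForm n (some q) (some p) x
      = -((1 / (segProd n p q x * (segProd n p q x - 1))) • fderiv ℂ (segProd n p q) x) := by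
  ext1 u
  have h0 := letter_ne_zero hx p
  have h5 := segProd_ne_zero hx p q
  have h1 : segProd n p q x - 1 ≠ 0 := sub_ne_zero.2 (segProd_ne_one hx hp hpq)
  have h2 : letter n none x = 0 := rfl
  have h3 : fderiv ℂ (letter n none) x = 0 := by
    rw [show letter n none = fun _ => (0 : ℂ) from rfl]; simp
  have h4 : segProd n p q x * letter n (some p) x - letter n (some p) x
    = letter n (some p) x * (segProd n p q x - 1) := by ring
  simp only [sub_apply, dlogForm_apply hx, fderiv_letter_eq_segProd hx hpq, h2, h3,
    letter_eq_segProd_mul hx hpq.le, smul_apply, zero_apply, smul_eq_mul, neg_apply, h4]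
  field_simp
  ring

end
end Letters

/-! ### Words as lists -/

section Lists
variable {n : ℕ}

/-- The sequence of letters of a word with start letter `p` and end letter `some n`. -/
def toSeq (n : ℕ) (p : Option ℕ) (w : List (Option ℕ)) (k : ℕ) : Option ℕ :=
  (p :: w).getD k (some n)

lemma toSeq_comp_skip (p : Option ℕ) (w : List (Option ℕ)) (i : ℕ) :
    toSeq n p w ∘ skip i = toSeq n p (w.eraseIdx i) := by
  funext k
  rcases k with _ | k
  · simp [toSeq, skip]
  · simp only [toSeq, skip, Function.comp, List.getD_eq_getElem?_getD]
    split_ifs with h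
    · simp [List.getElem?_eraseIdx_of_lt (show k < i from h)]
    · simp [List.getElem?_eraseIdx_of_ge (show i ≤ k by omega)]

/-- The flat section `wordFun` on words given as lists. -/
def listFun (p : Fin n → ℂ) (w : List (Option ℕ)) (x : Fin n → ℂ) : ℂ :=
  wordFun (dlogForm n) p w.length (toSeq n none w) x

/-- The next letter of a word, `some n` at its end. -/
def nextLetter (n : ℕ) (w : List (Option ℕ)) : Option ℕ := w.headD (some n)

/-- The sum over all letters of the word `w`, with prefix `pre` and preceding letter `p`, of the
contributions of their removal. -/
def removalSum (Φ : List (Option ℕ) → ℂ) (x : Fin n → ℂ) :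
    List (Option ℕ) → Option ℕ → List (Option ℕ) → ((Fin n → ℂ) →L[ℂ] ℂ)
  | _, _, [] => 0
  | pre, p, c :: r => Φ (pre ++ r) • (dlogForm n c (nextLetter n r) x - dlogForm n c p x)
      + removalSum Φ x (pre ++ [c]) c r

lemma removalSum_eq_sum (Φ : List (Option ℕ) → ℂ) (x : Fin n → ℂ) (w : List (Option ℕ)) :
    ∀ pre p, removalSum Φ x pre p w = ∑ i ∈ Finset.range w.length,
      Φ (pre ++ w.eraseIdx i) • removalForm (dlogForm n) (toSeq n p w) i x := by
  induction w with
  | nil => simp [removalSum]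
  | cons c r ih =>
    intro pre p
    rw [removalSum, List.length_cons, Finset.sum_range_succ', ih, add_comm]
    congr 1
    · refine Finset.sum_congr rfl fun i _ => ?_
      simp [removalForm, toSeq]
    · rcases r with _ | ⟨d, r⟩ <;> simp [removalForm, toSeq, nextLetter]

lemma hasFDerivAt_listFun {p : Fin n → ℂ} (hp : p ∈ polydisc n) (w : List (Option ℕ))
    {x : Fin n → ℂ} (hx : x ∈ polydisc n) :
    HasFDerivAt (listFun p w) (removalSum (fun w' => listFun p w' x) x [] none w) x := by
  have h := isArnold_dlogForm.hasFDerivAt_wordFun isOpen_polydisc convex_polydisc hp w.length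
    (toSeq n none w) x hx
  suffices removalSum (fun w' => listFun p w' x) x [] none w
      = wordDeriv (dlogForm n) p w.length (toSeq n none w) x from this ▸ h
  rw [removalSum_eq_sum]
  rcases hw : w.length with _ | K
  · simp [wordDeriv]
  · refine Finset.sum_congr rfl fun i hi => ?_
    rw [toSeq_comp_skip, listFun, List.nil_append, List.length_eraseIdx_of_lt, hw]
    · rfl
    · simpa [hw] using hi

/-- Removing any zero of a run leaves the same word, and the coefficients telescope: only the two
ends of the run survive. -/
lemma removalSum_replicate (Φ : List (Option ℕ) → ℂ) (x : Fin n → ℂ) (w : List (Option ℕ)) (k : ℕ) :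
    ∀ pre p, removalSum Φ x pre p (List.replicate (k + 1) none ++ w)
      = Φ (pre ++ List.replicate k none ++ w) •
          (dlogForm n none (nextLetter n w) x - dlogForm n none p x)
        + removalSum Φ x (pre ++ List.replicate (k + 1) none) none w := by
  induction k with
  | zero => intro pre p; simp [removalSum]
  | succ k ih =>
    intro pre p
    rw [List.replicate_succ, List.cons_append, removalSum, ih]
    have h0 : dlogForm n none none x = 0 := by ext1 u; simp [dlogForm]
    have h1 : pre ++ [none] ++ List.replicate k none = pre ++ List.replicate (k + 1) none := by
      simp [List.replicate_succ]
    have h2 : pre ++ [none] ++ List.replicate (k + 1) none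
      = pre ++ none :: List.replicate (k + 1) none := by simp
    have h3 : nextLetter n (List.replicate (k + 1) none ++ w) = none := by
      simp [nextLetter, List.replicate_succ]
    rw [h1, h2, h3, h0, zero_sub, sub_zero, smul_sub, smul_neg, ← List.append_assoc]
    abel

/-- The letters contributed to a word by the position `t` of the index `v`. -/
def block (v : Fin n → ℕ) (t : Fin n) : List (Option ℕ) :=
  match v t with
  | 0 => []
  | k + 1 => some t.val :: List.replicate k none

/-- The word `a_{t₁} 0^{v_{t₁} - 1} a_{t₂} 0^{v_{t₂} - 1} ⋯` over a list of positions. -/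
def blocks (v : Fin n → ℕ) (L : List (Fin n)) : List (Option ℕ) := L.flatMap (block v)

lemma block_of_eq_zero {v : Fin n → ℕ} {t : Fin n} (h : v t = 0) : block v t = [] := by
  simp [block, h]

lemma block_of_eq_succ {v : Fin n → ℕ} {t : Fin n} {k : ℕ} (h : v t = k + 1) :
    block v t = some t.val :: List.replicate k none := by
  simp [block, h]

@[simp] lemma blocks_nil (v : Fin n → ℕ) : blocks v [] = [] := rfl

@[simp] lemma blocks_cons (v : Fin n → ℕ) (t : Fin n) (L : List (Fin n)) :
    blocks v (t :: L) = block v t ++ blocks v L := rfl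

@[simp] lemma blocks_append (v : Fin n → ℕ) (L L' : List (Fin n)) :
    blocks v (L ++ L') = blocks v L ++ blocks v L' := List.flatMap_append

lemma blocks_congr {v v' : Fin n → ℕ} {L : List (Fin n)} (h : ∀ t ∈ L, v t = v' t) :
    blocks v L = blocks v' L :=
  List.flatMap_congr fun t ht => by simp [block, h t ht]

lemma blocks_eq_nil {v : Fin n → ℕ} {L : List (Fin n)} (h : ∀ t ∈ L, v t = 0) :
    blocks v L = [] :=
  List.flatMap_eq_nil_iff.2 fun t ht => block_of_eq_zero (h t ht)

/-- The part of the contribution of the first letter of `w` which depends on the letter `p`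
before it. -/
def carry (Φ : List (Option ℕ) → ℂ) (x : Fin n → ℂ) (pre : List (Option ℕ)) (p : Option ℕ) :
    List (Option ℕ) → ((Fin n → ℂ) →L[ℂ] ℂ)
  | [] => 0
  | c :: r => Φ (pre ++ r) • (dlogForm n c none x - dlogForm n c p x)

/-- The contribution of the position `s`, with prefix `pre` and remaining word `w`. -/
def blockTerm (Φ : List (Option ℕ) → ℂ) (x : Fin n → ℂ) (v : Fin n → ℕ)
    (pre : List (Option ℕ)) (s : Fin n) (w : List (Option ℕ)) : (Fin n → ℂ) →L[ℂ] ℂ :=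
  match v s with
  | 0 => 0
  | 1 => Φ (pre ++ w) • (dlogForm n (some s.val) (nextLetter n w) x - dlogForm n (some s.val) none x)
      + carry Φ x (pre ++ [some s.val]) (some s.val) w
  | k + 2 => Φ (pre ++ some s.val :: List.replicate k none ++ w) •
      (dlogForm n none (nextLetter n w) x - dlogForm n none (some s.val) x)

lemma carry_none (Φ : List (Option ℕ) → ℂ) (x : Fin n → ℂ) (pre w : List (Option ℕ)) :
    carry Φ x pre none w = 0 := by
  cases w <;> simp [carry]

/-- The removal terms are regrouped by position. The coefficient for the first letter of a block is
split at the letter 0: the part comparing the preceding letter with 0 (`carry`) is charged to the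
preceding nonzero position, the rest stays. After a block containing zeros nothing is carried. -/
lemma removalSum_blocks (Φ : List (Option ℕ) → ℂ) (x : Fin n → ℂ) (v : Fin n → ℕ)
    (g : Fin n → ((Fin n → ℂ) →L[ℂ] ℂ)) (M : List (Fin n))
    (hg : ∀ L s L', M = L ++ s :: L' → blockTerm Φ x v (blocks v L) s (blocks v L') = g s)
    (L' : List (Fin n)) :
    ∀ L p, M = L ++ L' → removalSum Φ x (blocks v L) p (blocks v L')
      = carry Φ x (blocks v L) p (blocks v L') + (L'.map g).sum := by
  induction L' with
  | nil => intro L p _; simp [removalSum, carry]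
  | cons s L' ih =>
    intro L p hM
    have hM' : M = (L ++ [s]) ++ L' := by simp [hM]
    rw [List.map_cons, List.sum_cons, ← hg L s L' hM]
    have hpre : blocks v (L ++ [s]) = blocks v L ++ block v s := by simp
    rcases hv : v s with _ | _ | k
    · have h := ih (L ++ [s]) p hM'
      rw [hpre, block_of_eq_zero hv, List.append_nil] at h
      rw [blocks_cons, block_of_eq_zero hv, List.nil_append, h]
      simp [blockTerm, hv]
    · have h := ih (L ++ [s]) (some s.val) hM'
      rw [hpre, block_of_eq_succ hv] at h
      rw [blocks_cons, block_of_eq_succ hv]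
      rw [List.replicate_zero] at h ⊢
      rw [List.cons_append, List.nil_append, removalSum, carry, h]
      simp only [blockTerm, hv, smul_sub]
      abel
    · have h := ih (L ++ [s]) none hM'
      rw [hpre, block_of_eq_succ hv, carry_none, zero_add] at h
      rw [blocks_cons, block_of_eq_succ hv]
      rw [List.cons_append, removalSum, removalSum_replicate, carry]
      rw [show blocks v L ++ [some s.val] ++ List.replicate (k + 1) none
        = blocks v L ++ some s.val :: List.replicate (k + 1) none by simp, h]
      have h3 : nextLetter n (List.replicate (k + 1) none ++ blocks v L') = none := by
        simp [nextLetter, List.replicate_succ]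
      have h4 : blocks v L ++ [some s.val] ++ List.replicate k none ++ blocks v L'
        = blocks v L ++ some s.val :: List.replicate k none ++ blocks v L' := by simp
      simp only [blockTerm, hv, h3, h4]

/-- The word attached to an index. -/
def word (v : Fin n → ℕ) : List (Option ℕ) := blocks v (List.finRange n)

lemma removalSum_word (Φ : List (Option ℕ) → ℂ) (x : Fin n → ℂ) (v : Fin n → ℕ)
    (g : Fin n → ((Fin n → ℂ) →L[ℂ] ℂ))
    (hg : ∀ L s L', List.finRange n = L ++ s :: L' →
      blockTerm Φ x v (blocks v L) s (blocks v L') = g s) :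
    removalSum Φ x [] none (word v) = ∑ s, g s := by
  have := removalSum_blocks Φ x v g _ hg (List.finRange n) [] none rfl
  rw [blocks_nil, carry_none, zero_add] at this
  rw [word, this, Fin.sum_univ_def]

end Lists

/-! ### The differential equations in terms of indices -/

section Indices
variable {n : ℕ}

/-- The number of nonzero positions of `v` before `s`. -/
def rank (v : Fin n → ℕ) (s : Fin n) : ℕ := ((support v).filter (fun p => p < s)).card

/-- The 1-form `w` of a step in the coordinate `y`, at a component which increases to `c`. -/
def formOf (y : (Fin n → ℂ) → ℂ) (c : ℕ) (δ : Fin 2) (b : Prop) [Decidable b] : OneForm n := fun x =>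
  if 1 < c then
    if δ = 0 then (1 / y x) • fderiv ℂ y x else 0
  else
    if δ = 0 then (1 / (1 - y x)) • fderiv ℂ y x
    else if b then (1 / (y x * (y x - 1))) • fderiv ℂ y x
    else 0

/-- The 1-form of the step at the position `s` of the index `v`. -/
def indexForm (v : Fin n → ℕ) (s : Fin n) (δ : Fin 2) : OneForm n :=
  formOf (yCoord v (rank v s)) (v s) δ (rank v s + 1 < depth v)

/-- The permutation attached to the step at the position `s` of the index `v`. -/
def nextPerm (v : Fin n → ℕ) (s : Fin n) : Equiv.Perm (Fin n) :=
  if h : v s = 1 ∧ (laterSupport v s).Nonempty then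
    Equiv.swap s ((laterSupport v s).min' h.2)
  else 1

/-- The index obtained from `v` by a step down at the position `s`. -/
def indexStep (v : Fin n → ℕ) (s : Fin n) (δ : Fin 2) : Fin n → ℕ :=
  if δ = 0 then v - Pi.single s 1 else fun p => (v - Pi.single s 1 : Fin n → ℕ) (nextPerm v s p)

lemma smul_zero_form (c : ℂ) : c • (0 : (Fin n → ℂ) →L[ℂ] ℂ) = 0 := by ext; simp

lemma sort_support (v : Fin n → ℕ) :
    (support v).sort (· ≤ ·) = (List.finRange n).filter (fun p => v p ≠ 0) := by
  have h : support v = ((List.finRange n).filter (fun p => v p ≠ 0)).toFinset := by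
    ext p; simp [support]
  rw [h, List.toFinset_sort (r := (· ≤ ·)) ((List.nodup_finRange n).filter _)]
  exact (List.sortedLT_finRange n).sortedLE.pairwise.filter _

lemma nextLetter_blocks (v : Fin n → ℕ) (L : List (Fin n)) :
    nextLetter n (blocks v L)
      = some (((L.filter (fun p => v p ≠ 0)).map Fin.val).headD n) := by
  induction L with
  | nil => rfl
  | cons t L ih =>
    rcases hv : v t with _ | k
    · simpa [block_of_eq_zero hv, hv] using ih
    · simp [block_of_eq_succ hv, hv, nextLetter]

section Split
variable {v : Fin n → ℕ} {L L' : List (Fin n)} {s : Fin n} (h : List.finRange n = L ++ s :: L')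
include h

lemma lt_of_mem_left {t : Fin n} (ht : t ∈ L) : t < s := by
  have := (List.sortedLT_finRange n).pairwise
  rw [h, List.pairwise_append] at this
  exact this.2.2 t ht s (by simp)

lemma lt_of_mem_right {t : Fin n} (ht : t ∈ L') : s < t := by
  have := (List.sortedLT_finRange n).pairwise
  rw [h, List.pairwise_append, List.pairwise_cons] at this
  exact this.2.1.1 t ht

lemma mem_left_iff {t : Fin n} : t ∈ L ↔ t < s := by
  refine ⟨lt_of_mem_left h, fun ht => ?_⟩
  have : t ∈ L ++ s :: L' := h ▸ List.mem_finRange t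
  rcases List.mem_append.1 this with h1 | h1
  · exact h1
  · rcases List.mem_cons.1 h1 with rfl | h2
    · exact absurd ht (lt_irrefl _)
    · exact absurd (lt_of_mem_right h h2) ht.not_gt

lemma mem_right_iff {t : Fin n} : t ∈ L' ↔ s < t := by
  refine ⟨lt_of_mem_right h, fun ht => ?_⟩
  have : t ∈ L ++ s :: L' := h ▸ List.mem_finRange t
  rcases List.mem_append.1 this with h1 | h1
  · exact absurd (lt_of_mem_left h h1) ht.not_gt
  · rcases List.mem_cons.1 h1 with rfl | h2
    · exact absurd ht (lt_irrefl _)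
    · exact h2

lemma rank_eq_length : rank v s = (L.filter (fun p => v p ≠ 0)).length := by
  have hn : (L.filter (fun p => v p ≠ 0)).Nodup := by
    have := List.nodup_finRange n
    rw [h] at this
    exact this.of_append_left.filter _
  rw [← List.toFinset_card_of_nodup hn, rank]
  congr 1
  ext t
  simp [support, mem_left_iff h, and_comm]

lemma filter_finRange (hs : v s ≠ 0) : (List.finRange n).filter (fun p => v p ≠ 0)
    = L.filter (fun p => v p ≠ 0) ++ s :: L'.filter (fun p => v p ≠ 0) := by
  rw [h, List.filter_append, List.filter_cons_of_pos (by simpa using hs)]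

lemma depth_eq_length (hs : v s ≠ 0) :
    depth v = rank v s + 1 + (L'.filter (fun p => v p ≠ 0)).length := by
  rw [depth, ← Finset.length_sort (· ≤ ·), sort_support, filter_finRange h hs, rank_eq_length h]
  simp; omega

lemma nonzeroPos_rank (hs : v s ≠ 0) : nonzeroPos v (rank v s) = s := by
  rw [nonzeroPos, sort_support, filter_finRange h hs, rank_eq_length h]
  simp [List.getD_eq_getElem?_getD]

lemma nonzeroPos_rank_succ (hs : v s ≠ 0) : nonzeroPos v (rank v s + 1)
    = ((L'.filter (fun p => v p ≠ 0)).map Fin.val).headD n := by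
  rw [nonzeroPos, sort_support, filter_finRange h hs, rank_eq_length h]
  simp [List.getD_eq_getElem?_getD, List.getElem?_append_right, List.headD_eq_head?_getD, List.head?_eq_getElem?]

lemma yCoord_rank (hs : v s ≠ 0) : yCoord v (rank v s)
    = segProd n s (((L'.filter (fun p => v p ≠ 0)).map Fin.val).headD n) := by
  funext x
  rw [yCoord, nonzeroPos_rank h hs, nonzeroPos_rank_succ h hs, segProd]

lemma lt_next : (s : ℕ) < ((L'.filter (fun p => v p ≠ 0)).map Fin.val).headD n := by
  rcases hf : L'.filter (fun p => v p ≠ 0) with _ | ⟨a, r⟩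
  · simp
  · simp only [List.map_cons, List.headD_cons]
    refine lt_of_mem_right h (List.mem_of_mem_filter (p := fun p => v p ≠ 0) ?_)
    rw [hf]; simp

lemma word_eq_of_split {v' : Fin n → ℕ} (hv : ∀ t, t ≠ s → v' t = v t) :
    word v' = blocks v L ++ block v' s ++ blocks v L' := by
  rw [word, h, blocks_append, blocks_cons, List.append_assoc,
    blocks_congr fun t ht => hv t (lt_of_mem_left h ht).ne,
    blocks_congr fun t ht => hv t (lt_of_mem_right h ht).ne']

end Split

/-- The flat section attached to an index, normalised by the sign `(-1)^depth`. -/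
def indexFun (p : Fin n → ℂ) (v : Fin n → ℕ) (x : Fin n → ℂ) : ℂ :=
  (-1) ^ (word v).countP Option.isSome * listFun p (word v) x

/-- Removing a zero of the block, or a lone letter `a_s`, is the step `δ = 0`. If `a_s` is alone and
`a` is the next nonzero position, the carried term removes `a_a` instead; what remains is `a_s`
followed by the zeros of block `a`, which is the word of the transposed index, `δ = 1`. Losing a
nonzero letter changes the sign `(-1)^depth`, matching the minus signs in `dlogForm_some_sub` and
`dlogForm_next_sub`. -/
lemma blockTerm_eq {p x : Fin n → ℂ} (hx : x ∈ polydisc n) {v : Fin n → ℕ} {s : Fin n}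
    {L L' : List (Fin n)} (h : List.finRange n = L ++ s :: L') :
    blockTerm (fun w => listFun p w x) x v (blocks v L) s (blocks v L')
      = (-1 : ℂ) ^ (word v).countP Option.isSome •
        if v s ≠ 0 then ∑ δ, indexFun p (indexStep v s δ) x • indexForm v s δ x else 0 := by
  have hword : word v = blocks v L ++ block v s ++ blocks v L' := word_eq_of_split h fun _ _ => rfl
  have hstep0 : word (indexStep v s 0) = blocks v L ++ block (indexStep v s 0) s ++ blocks v L' :=
    word_eq_of_split h fun t ht => by simp [indexStep, Pi.single_eq_of_ne ht]
  have hstep0s : indexStep v s 0 s = v s - 1 := by simp [indexStep]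
  rcases hv : v s with _ | _ | k
  · simp [blockTerm, hv, smul_zero_form]
  · have hs : v s ≠ 0 := by omega
    rw [if_pos (by omega), Fin.sum_univ_two]
    rw [block_of_eq_zero (by rw [hstep0s, hv]), List.append_nil] at hstep0
    rw [block_of_eq_succ hv, List.replicate_zero] at hword
    have hform0 : indexForm v s 0 x = -(dlogForm n (some s.val) (nextLetter n (blocks v L')) x
        - dlogForm n (some s.val) none x) := by
      rw [nextLetter_blocks, dlogForm_some_sub hx s.2 (lt_next h), indexForm, formOf,
        yCoord_rank h hs, if_neg (by omega), if_pos rfl, neg_neg]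
    simp only [blockTerm, hv]
    rw [smul_add]
    congr 1
    · rw [indexFun, hstep0, hform0, hword]
      simp only [List.countP_append, List.countP_cons, Option.isSome_some, List.countP_nil]
      rw [smul_smul, smul_neg, ← neg_smul]
      congr 1
      simp only [if_true, pow_add, pow_one, zero_add]
      have e1 := pow_mul_pow_eq_one ((blocks v L).countP Option.isSome) (show (-1 : ℂ) * -1 = 1 by norm_num)
      have e2 := pow_mul_pow_eq_one ((blocks v L').countP Option.isSome) (show (-1 : ℂ) * -1 = 1 by norm_num)
      linear_combination (-(listFun p (blocks v L ++ blocks v L') x) *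
        ((-1) ^ (blocks v L').countP Option.isSome * (-1) ^ (blocks v L').countP Option.isSome)) * e1
        - listFun p (blocks v L ++ blocks v L') x * e2
    · by_cases hne : (laterSupport v s).Nonempty
      · set a := (laterSupport v s).min' hne with ha
        have ham : a ∈ laterSupport v s := Finset.min'_mem _ _
        simp only [laterSupport, support, Finset.mem_filter, Finset.mem_univ, true_and] at ham
        obtain ⟨Z, L₃, hL'⟩ := List.append_of_mem ((mem_right_iff h).2 ham.2)
        have h' : List.finRange n = (L ++ s :: Z) ++ a :: L₃ := by rw [h, hL']; simp
        have hZ : ∀ t ∈ Z, v t = 0 := fun t ht => by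
          by_contra hvt
          have h1 : t < a := lt_of_mem_left h' (by simp [ht])
          have h2 : s < t := lt_of_mem_right h (by simp [hL', ht])
          exact h1.not_ge (Finset.min'_le _ _ (by simp [laterSupport, support, hvt, h2]))
        have hZf : Z.filter (fun p => v p ≠ 0) = [] := by
          rw [List.filter_eq_nil_iff]; intro t ht; simp [hZ t ht]
        have hL'f : L'.filter (fun p => v p ≠ 0) = a :: L₃.filter (fun p => v p ≠ 0) := by
          rw [hL', List.filter_append, hZf, List.filter_cons_of_pos (by simpa using ham.1),
            List.nil_append]
        obtain ⟨k, hk⟩ := Nat.exists_eq_succ_of_ne_zero ham.1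
        have hbL' : blocks v L' = some a.val :: (List.replicate k none ++ blocks v L₃) := by
          rw [hL', blocks_append, blocks_cons, blocks_eq_nil hZ, block_of_eq_succ hk]; rfl
        have hstep : indexStep v s 1 = fun t => (v - Pi.single s 1 : Fin n → ℕ) (Equiv.swap s a t) := by
          rw [indexStep, if_neg (by decide), nextPerm, dif_pos ⟨hv, hne⟩]
        have hz1 : ∀ t, t ≠ s → t ≠ a → indexStep v s 1 t = v t := fun t h1 h2 => by
          rw [hstep]
          simp [Equiv.swap_apply_of_ne_of_ne h1 h2, h1]
        -- The step down empties `s`, so the exchange leaves 0 at `a` and puts the whole value `v a`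
        -- at `s`.
        have hz2 : indexStep v s 1 a = 0 := by rw [hstep]; simp [hv]
        have hz3 : indexStep v s 1 s = k + 1 := by rw [hstep]; simp [hk, ham.2.ne']
        have hw1 : word (indexStep v s 1)
            = blocks v L ++ some s.val :: (List.replicate k none ++ blocks v L₃) := by
          rw [word, h, hL', blocks_append, blocks_cons, blocks_append, blocks_cons,
            block_of_eq_succ hz3, block_of_eq_zero hz2,
            blocks_eq_nil (L := Z), blocks_congr (L := L₃) (v' := v), blocks_congr (L := L) (v' := v)]
          · simp
          · exact fun t ht => hz1 t (lt_of_mem_left h ht).ne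
              (lt_of_mem_left h' (by simp [ht])).ne
          · exact fun t ht => hz1 t (lt_of_mem_right h (by simp [hL', ht])).ne'
              (lt_of_mem_right h' ht).ne'
          · exact fun t ht => (hz1 t (lt_of_mem_right h (by simp [hL', ht])).ne'
              (lt_of_mem_left h' (by simp [ht])).ne).trans (hZ t ht)
        have hform1 : indexForm v s 1 x = -(dlogForm n (some a.val) none x
            - dlogForm n (some a.val) (some s.val) x) := by
          have hsa : s.val < a.val := ham.2
          rw [dlogForm_next_sub hx s.2 hsa, indexForm, formOf,
            yCoord_rank h hs, hL'f, if_neg (by omega), if_neg (by decide), if_pos, neg_neg]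
          · rfl
          · rw [depth_eq_length h hs, hL'f]; simp
        rw [hbL', carry, hform1, indexFun, hw1, hword, hbL']
        simp only [List.countP_append, List.countP_cons, Option.isSome_some,
          List.append_assoc, List.cons_append, List.nil_append, List.countP_replicate]
        rw [smul_smul, smul_neg, ← neg_smul]
        congr 1
        simp only [if_true, pow_add, pow_one, zero_add, Option.isSome_none, Bool.false_eq_true,
          if_false]
        have e1 := pow_mul_pow_eq_one ((blocks v L).countP Option.isSome) (show (-1 : ℂ) * -1 = 1 by norm_num)
        have e2 := pow_mul_pow_eq_one ((blocks v L₃).countP Option.isSome) (show (-1 : ℂ) * -1 = 1 by norm_num)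
        set F := listFun p (blocks v L ++ some s.val :: (List.replicate k none ++ blocks v L₃)) x
        linear_combination (-F *
          ((-1) ^ (blocks v L₃).countP Option.isSome * (-1) ^ (blocks v L₃).countP Option.isSome)) * e1
          - F * e2
      · have hz : ∀ t ∈ L', v t = 0 := fun t ht => by
          by_contra hvt
          exact hne ⟨t, by simp [laterSupport, support, hvt, lt_of_mem_right h ht]⟩
        have hL'f : L'.filter (fun p => v p ≠ 0) = [] := by
          rw [List.filter_eq_nil_iff]; intro t ht; simp [hz t ht]
        have hform1 : indexForm v s 1 x = 0 := by
          rw [indexForm, formOf, if_neg (by omega), if_neg (by decide), if_neg]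
          rw [depth_eq_length h hs, hL'f]; simp
        rw [blocks_eq_nil hz, carry, hform1, smul_zero_form, smul_zero_form]
  · have hs : v s ≠ 0 := by omega
    rw [if_pos (by omega), Fin.sum_univ_two]
    rw [block_of_eq_succ (k := k) (by rw [hstep0s, hv]; rfl)] at hstep0
    rw [block_of_eq_succ hv] at hword
    have hform0 : indexForm v s 0 x = dlogForm n none (nextLetter n (blocks v L')) x
        - dlogForm n none (some s.val) x := by
      rw [nextLetter_blocks, dlogForm_none_sub hx (lt_next h), indexForm, formOf,
        yCoord_rank h hs, if_pos (by omega), if_pos rfl]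
    have hform1 : indexForm v s 1 x = 0 := by
      rw [indexForm, formOf, if_pos (by omega), if_neg (by decide)]
    have hc : (word (indexStep v s 0)).countP Option.isSome = (word v).countP Option.isSome := by
      rw [hstep0, hword]
      simp [List.countP_append, List.countP_replicate]
    simp only [blockTerm, hv]
    rw [hform0, hform1, smul_zero_form, add_zero, indexFun, hc, smul_smul, ← mul_assoc,
      pow_mul_pow_eq_one _ (show (-1 : ℂ) * -1 = 1 by norm_num), one_mul, hstep0]

theorem hasFDerivAt_indexFun {p : Fin n → ℂ} (hp : p ∈ polydisc n) (v : Fin n → ℕ)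
    {x : Fin n → ℂ} (hx : x ∈ polydisc n) :
    HasFDerivAt (indexFun p v)
      (∑ s ∈ support v, ∑ δ, indexFun p (indexStep v s δ) x • indexForm v s δ x) x := by
  have h := (hasFDerivAt_listFun hp (word v) hx).const_mul ((-1) ^ (word v).countP Option.isSome)
  rw [removalSum_word _ x v _ fun L s L' hL => blockTerm_eq hx hL, ← Finset.smul_sum, smul_smul,
    pow_mul_pow_eq_one _ (show (-1 : ℂ) * -1 = 1 by norm_num), one_smul,
    ← Finset.sum_filter] at h
  exact h

lemma indexFun_zero (p x : Fin n → ℂ) : indexFun p 0 x = 1 := by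
  have : word (0 : Fin n → ℕ) = [] := blocks_eq_nil fun _ _ => rfl
  simp [indexFun, this, listFun]

lemma indexFun_base (p : Fin n → ℂ) {v : Fin n → ℕ} (hv : v ≠ 0) : indexFun p v p = 0 := by
  obtain ⟨t, ht⟩ := Function.ne_iff.1 hv
  obtain ⟨k, hk⟩ := Nat.exists_eq_succ_of_ne_zero ht
  rw [indexFun, listFun]
  rcases hw : word v with _ | ⟨c, r⟩
  · have := List.flatMap_eq_nil_iff.1 hw t (List.mem_finRange t)
    simp [block_of_eq_succ hk] at this
  · simp

end Indices

/-! ### Integration of 1-forms along piecewise continuously differentiable paths -/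

section Paths
variable {n : ℕ}

lemma segProd_eq_one {p q : ℕ} (h : ¬(p < n ∧ p < q)) : segProd n p q = fun _ => 1 := by
  funext x
  unfold segProd
  rw [Finset.filter_false_of_mem, Finset.prod_empty]
  intro α _
  have := α.2
  omega

lemma continuousOn_formOf_segProd (p q c : ℕ) (δ : Fin 2) (b : Prop) [Decidable b] :
    ContinuousOn (formOf (segProd n p q) c δ b) (polydisc n) := by
  by_cases h : p < n ∧ p < q
  · have h1 : Continuous (segProd n p q) := (differentiable_segProd p q).continuous
    have h2 : Continuous (fderiv ℂ (segProd n p q)) := by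
      have : ContDiff ℂ 1 (segProd n p q) := by unfold segProd; fun_prop
      exact this.continuous_fderiv (by norm_num)
    have h3 : ∀ x ∈ polydisc n, segProd n p q x ≠ 0 := fun x hx => segProd_ne_zero hx p q
    have h4 : ∀ x ∈ polydisc n, 1 - segProd n p q x ≠ 0 := fun x hx =>
      sub_ne_zero.2 (segProd_ne_one hx h.1 h.2).symm
    have h5 : ∀ x ∈ polydisc n, segProd n p q x * (segProd n p q x - 1) ≠ 0 := fun x hx =>
      mul_ne_zero (h3 x hx) (sub_ne_zero.2 (segProd_ne_one hx h.1 h.2))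
    unfold formOf
    split_ifs
    · exact (continuousOn_const.div h1.continuousOn h3).smul h2.continuousOn
    · exact continuousOn_const
    · exact (continuousOn_const.div (by fun_prop) h4).smul h2.continuousOn
    · exact (continuousOn_const.div (by fun_prop) h5).smul h2.continuousOn
    · exact continuousOn_const
  -- The product is empty, hence constantly 1: coefficients such as `1 / (1 - y)` are divisions by
  -- zero, but `dy = 0`.
  · have : formOf (segProd n p q) c δ b = fun _ => 0 := by
      funext x
      have : fderiv ℂ (segProd n p q) x = 0 := by rw [segProd_eq_one h]; simp
      unfold formOf
      rw [this]
      simp only [smul_zero_form, ite_self]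
    rw [this]
    exact continuousOn_const

lemma continuousOn_formOf (i : Fin n → ℕ) (l c : ℕ) (δ : Fin 2) (b : Prop) [Decidable b] :
    ContinuousOn (formOf (yCoord i l) c δ b) (polydisc n) :=
  continuousOn_formOf_segProd (nonzeroPos i l) (nonzeroPos i (l + 1)) c δ b

lemma exists_mem_Ioo_of_partition {N : ℕ} {t : Fin (N + 1) → ℝ} {s : ℝ} (hs : t 0 < s)
    (hst : s ∉ range t) : ∀ i : Fin (N + 1), s < t i →
      ∃ j : Fin N, s ∈ Ioo (t j.castSucc) (t j.succ) := by
  intro i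
  induction i using Fin.induction with
  | zero => exact fun h => absurd h hs.not_gt
  | succ i ih =>
    intro h
    rcases lt_trichotomy s (t i.castSucc) with h1 | h1 | h1
    · exact ih h1
    · exact absurd ⟨_, h1.symm⟩ hst
    · exact ⟨i, h1, h⟩

section
variable {D : Set (Fin n → ℂ)} {γ : ℝ → Fin n → ℂ} (hγ : IsPiecewiseC1 γ)
  (hD : ∀ t ∈ Icc (0 : ℝ) 1, γ t ∈ D)
include hγ

lemma IsPiecewiseC1.exists_countable :
    ∃ S : Set ℝ, S.Countable ∧ ∀ t ∈ Ioo (0 : ℝ) 1 \ S, HasDerivAt γ (deriv γ t) t := by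
  obtain ⟨-, N, t, -, h0, h1, hd⟩ := hγ
  refine ⟨range t, countable_range t, fun s hs => ?_⟩
  obtain ⟨j, hj⟩ := exists_mem_Ioo_of_partition (h0 ▸ hs.1.1) hs.2 (Fin.last N) (h1 ▸ hs.1.2)
  exact (((hd j).differentiableOn (by norm_num)).differentiableAt
    (Icc_mem_nhds hj.1 hj.2)).hasDerivAt

include hD

/-- On each closed piece `deriv γ` agrees in the interior with a one-sided derivative that is
continuous up to the ends; its values at the partition points do not matter. -/
lemma IsPiecewiseC1.intervalIntegrable {ω : OneForm n} (hω : ContinuousOn ω D) :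
    IntervalIntegrable (fun t => ω (γ t) (deriv γ t)) MeasureTheory.volume 0 1 := by
  obtain ⟨hc, N, t, hmono, h0, h1, hd⟩ := hγ
  have hmem : ∀ i, t i ∈ Icc (0 : ℝ) 1 := fun i =>
    ⟨h0 ▸ hmono.monotone (Fin.zero_le i), h1 ▸ hmono.monotone (Fin.le_last i)⟩
  suffices ∀ i : Fin (N + 1), IntervalIntegrable (fun t => ω (γ t) (deriv γ t))
      MeasureTheory.volume 0 (t i) from h1 ▸ this (Fin.last N)
  intro i
  induction i using Fin.induction with
  | zero => rw [h0]
  | succ i ih =>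
    refine ih.trans ?_
    have hlt : t i.castSucc < t i.succ := hmono i.castSucc_lt_succ
    have hsub : Icc (t i.castSucc) (t i.succ) ⊆ Icc 0 1 := Icc_subset_Icc (hmem _).1 (hmem _).2
    have h2 : ContinuousOn (fun s => ω (γ s) (derivWithin γ (Icc (t i.castSucc) (t i.succ)) s))
        (Icc (t i.castSucc) (t i.succ)) := by
      refine ContinuousOn.clm_apply (hω.comp (hc.mono hsub) fun s hs => hD s (hsub hs)) ?_
      exact (hd i).continuousOn_derivWithin (uniqueDiffOn_Icc hlt) (by norm_num)
    rw [← uIcc_of_le hlt.le] at h2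
    refine (h2.intervalIntegrable).congr_uIoo fun s hs => ?_
    rw [uIoo_of_le hlt.le] at hs
    simp only [uIcc_of_le hlt.le]
    rw [derivWithin_of_mem_nhds (Icc_mem_nhds hs.1 hs.2)]

lemma IsPiecewiseC1.integral_eq {ω : OneForm n} (hω : ContinuousOn ω D) {F : (Fin n → ℂ) → ℂ}
    (hF : ∀ x ∈ D, HasFDerivAt F (ω x) x) {b : ℝ} (hb : b ∈ Icc (0 : ℝ) 1) :
    ∫ t in (0 : ℝ)..b, ω (γ t) (deriv γ t) = F (γ b) - F (γ 0) := by
  obtain ⟨S, hS, hd⟩ := hγ.exists_countable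
  have hsub : uIcc 0 b ⊆ Icc (0 : ℝ) 1 := by
    rw [uIcc_of_le hb.1]; exact Icc_subset_Icc le_rfl hb.2
  refine MeasureTheory.integral_eq_of_hasDerivAt_off_countable (fun t => F (γ t)) _ hS ?_ ?_ ?_
  · refine ContinuousOn.comp (t := D) (fun x hx => (hF x hx).continuousAt.continuousWithinAt)
      (hγ.1.mono hsub) fun s hs => hD s (hsub hs)
  · intro t ht
    rw [min_eq_left hb.1, max_eq_right hb.1] at ht
    have ht1 : t ∈ Ioo (0 : ℝ) 1 := ⟨ht.1.1, ht.1.2.trans_le hb.2⟩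
    exact ((hF _ (hD t (Ioo_subset_Icc_self ht1))).restrictScalars ℝ).comp_hasDerivAt t (hd t ⟨ht1, ht.2⟩)
  · exact (hγ.intervalIntegrable hD hω).mono_set (by rw [uIcc_of_le zero_le_one]; exact hsub)

end

lemma continuousOn_iteratedIntegral {r : ℕ} (f : Fin r → ℝ → ℂ)
    (hf : ∀ i, IntervalIntegrable (f i) MeasureTheory.volume 0 1) :
    ContinuousOn (iteratedIntegral 0 r f) (Icc 0 1) := by
  induction r with
  | zero => exact continuousOn_const
  | succ r ih =>
    have h1 := ih (fun i => f i.castSucc) fun i => hf _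
    rw [← uIcc_of_le (zero_le_one (α := ℝ))] at h1 ⊢
    have h2 := (hf (Fin.last r)).continuousOn_mul h1
    exact intervalIntegral.continuousOn_primitive_interval ((intervalIntegrable_iff' ).1 h2)

end Paths

/-! ### Vector indices by their last entry -/

section VectorIndices
variable {n : ℕ}

/-- The vector indices of length `K` which end in `m`. -/
def vecIdx (K : ℕ) (m : Fin n → ℕ) : Finset (Fin K → Fin n → ℕ) :=
  open Classical in
  (Fintype.piFinset fun _ => indexSet m).filter fun j =>
    (∀ t, ∑ i, j t i = t.val + 1) ∧ Monotone j ∧ ∀ t, t.val + 1 = K → j t = m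

lemma mem_vecIdx {K : ℕ} {m : Fin n → ℕ} {j : Fin K → Fin n → ℕ} :
    j ∈ vecIdx K m ↔ (∀ t, j t ≤ m) ∧ (∀ t, ∑ i, j t i = t.val + 1) ∧ Monotone j ∧
      ∀ t, t.val + 1 = K → j t = m := by
  simp [vecIdx, indexSet]

/-- The last entry before the end `m` of a vector index of length `K + 1`. -/
lemma prevIndex_last {K : ℕ} {m' m : Fin n → ℕ} (hm' : ∑ i, m' i = K) {j : Fin K → Fin n → ℕ}
    (hj : j ∈ vecIdx K m') :
    prevIndex (Fin.snoc (α := fun _ => Fin n → ℕ) j m) (Fin.last K) = m' := by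
  rcases K with _ | K
  · have : m' = 0 := by
      funext i
      exact (Finset.sum_eq_zero_iff.1 hm') i (Finset.mem_univ i)
    simp [prevIndex, this]
  · rw [prevIndex, if_neg (by simp)]
    have : (⟨(Fin.last (K + 1)).val - 1, by simp⟩ : Fin (K + 2)) = (Fin.last K).castSucc := by
      ext; simp
    rw [this, Fin.snoc_castSucc]
    exact (mem_vecIdx.1 hj).2.2.2 _ (by simp)

lemma sub_add_single {m : Fin n → ℕ} {s : Fin n} (hs : m s ≠ 0) :
    m - Pi.single s 1 + Pi.single s 1 = m := by
  funext t
  rcases eq_or_ne t s with rfl | h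
  · simp; omega
  · simp [h]

lemma sum_sub_single {m : Fin n → ℕ} {s : Fin n} (hs : m s ≠ 0) {K : ℕ} (hm : ∑ i, m i = K + 1) :
    ∑ i, (m - Pi.single s 1 : Fin n → ℕ) i = K := by
  rw [← sub_add_single hs] at hm
  simp only [Pi.add_apply, Finset.sum_add_distrib, Finset.sum_pi_single', Finset.mem_univ,
    if_true] at hm
  omega

lemma single_injective {s t : Fin n} (h : (Pi.single s 1 : Fin n → ℕ) = Pi.single t 1) : s = t := by
  by_contra hne
  have := congrFun h s
  simp [hne] at this

lemma exists_eq_add_single {m' m : Fin n → ℕ} (h : m' ≤ m) (hs : ∑ i, m i = ∑ i, m' i + 1) :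
    ∃ s, m = m' + Pi.single s 1 := by
  have h1 : ∃ s, m' s < m s := by
    by_contra! hcon
    have := Finset.sum_le_sum fun i (_ : i ∈ Finset.univ) => hcon i
    omega
  obtain ⟨s, hs1⟩ := h1
  refine ⟨s, funext fun t => ?_⟩
  have hle : m' + Pi.single s 1 ≤ m := fun t => by
    rcases eq_or_ne t s with rfl | hne
    · simpa using hs1
    · simpa [hne] using h t
  have hsum : ∑ i, (m' + Pi.single s 1 : Fin n → ℕ) i = ∑ i, m i := by
    rw [hs]; simp [Finset.sum_add_distrib]
  exact ((Finset.sum_eq_sum_iff_of_le fun i _ => hle i).1 hsum t (Finset.mem_univ t)).symm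

variable [NeZero n]

lemma stepPos_eq {K : ℕ} {j : Fin K → Fin n → ℕ} {r : Fin K} {s : Fin n}
    (h : j r = prevIndex j r + Pi.single s 1) : stepPos j r = s := by
  have h2 : j r = prevIndex j r + Pi.single (stepPos j r) 1 :=
    Classical.epsilon_spec (p := fun s => j r = prevIndex j r + Pi.single s 1) ⟨s, h⟩
  rw [h] at h2
  exact (single_injective (add_left_cancel h2)).symm

section Snoc
variable {K : ℕ} (j : Fin K → Fin n → ℕ) (m : Fin n → ℕ)

/-- The vector index `j` followed by `m`. -/
abbrev snocIdx : Fin (K + 1) → Fin n → ℕ := Fin.snoc (α := fun _ => Fin n → ℕ) j m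

omit [NeZero n] in
lemma prevIndex_snoc (r : Fin K) : prevIndex (snocIdx j m) r.castSucc = prevIndex j r := by
  have hr : r.val - 1 < K := lt_of_le_of_lt (Nat.sub_le _ _) r.isLt
  change (if r.val = 0 then 0 else snocIdx j m (⟨r.val - 1, hr⟩ : Fin K).castSucc) = _
  rw [snocIdx, Fin.snoc_castSucc]
  rfl

lemma stepPos_snoc (r : Fin K) : stepPos (snocIdx j m) r.castSucc = stepPos j r := by
  unfold stepPos
  rw [prevIndex_snoc, snocIdx, Fin.snoc_castSucc]

lemma stepPerm_eq_nextPerm {K : ℕ} (j : Fin K → Fin n → ℕ) (r : Fin K) :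
    stepPerm j r = nextPerm (j r) (stepPos j r) := rfl

lemma stepRank_eq_rank {K : ℕ} (j : Fin K → Fin n → ℕ) (r : Fin K) :
    stepRank j r = rank (j r) (stepPos j r) := rfl

lemma transposition_snoc (r : Fin K) (d : Fin 2) (i : Fin n → ℕ) :
    transposition (snocIdx j m) r.castSucc d i = transposition j r d i := by
  unfold transposition
  rw [stepPerm_eq_nextPerm, stepPerm_eq_nextPerm, stepPos_snoc, snocIdx, Fin.snoc_castSucc]

lemma transposedIndex_snoc_last (δ : Fin (K + 1) → Fin 2) :
    transposedIndex (snocIdx j m) δ (Fin.last K) = m := by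
  unfold transposedIndex
  rw [List.filter_eq_nil_iff.2, List.foldl_nil, snocIdx, Fin.snoc_last]
  intro t _
  simpa using Fin.le_last t

/-- The last transposition is applied outermost, so deleting the final step strips exactly that one.
-/
lemma transposedIndex_snoc_castSucc (δ : Fin K → Fin 2) (d : Fin 2) (r : Fin K) :
    transposedIndex (snocIdx j m) (Fin.snoc (α := fun _ => Fin 2) δ d) r.castSucc
      = transposition (snocIdx j m) (Fin.last K) d (transposedIndex j δ r) := by
  unfold transposedIndex
  rw [List.finRange_succ_last, List.filter_append, List.foldl_append, List.filter_map,
    List.foldl_map]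
  simp only [Fin.snoc_castSucc, transposition_snoc, Function.comp_def, Fin.castSucc_lt_castSucc_iff,
    snocIdx]
  simp [Fin.castSucc_lt_last]

end Snoc

/-- Vector indices ending in `m` are sorted by the position of their last step; this is the
combinatorial side of peeling off the last form. -/
lemma sum_vecIdx_succ {M : Type*} [AddCommMonoid M] {K : ℕ} {m : Fin n → ℕ}
    (hm : ∑ i, m i = K + 1) (g : Fin n → (Fin (K + 1) → Fin n → ℕ) → M) :
    ∑ j ∈ vecIdx (K + 1) m, g (stepPos j (Fin.last K)) j
      = ∑ s ∈ support m, ∑ j ∈ vecIdx K (m - Pi.single s 1), g s (snocIdx j m) := by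
  rw [Finset.sum_sigma']
  symm
  have hpos : ∀ s, m s ≠ 0 → ∀ j ∈ vecIdx K (m - Pi.single s 1),
      stepPos (snocIdx j m) (Fin.last K) = s := fun s hs j hj => by
    apply stepPos_eq
    rw [prevIndex_last (sum_sub_single hs hm) hj, snocIdx, Fin.snoc_last, sub_add_single hs]
  refine Finset.sum_bij' (fun a _ => snocIdx a.2 m)
    (fun j _ => ⟨stepPos j (Fin.last K), Fin.init j⟩) ?_ ?_ ?_ ?_ ?_
  · rintro ⟨s, j⟩ ha
    simp only [Finset.mem_sigma, support, Finset.mem_filter_univ] at ha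
    obtain ⟨h1, h2, h3, h4⟩ := mem_vecIdx.1 ha.2
    have hle : ∀ t, j t ≤ m := fun t => (h1 t).trans (by
      intro i; exact Nat.sub_le _ _)
    rw [mem_vecIdx]
    refine ⟨fun t => ?_, fun t => ?_, fun a b hab => ?_, fun t ht => ?_⟩
    · induction t using Fin.lastCases with
      | last => simp [snocIdx]
      | cast t => simpa [snocIdx] using hle t
    · induction t using Fin.lastCases with
      | last => simpa [snocIdx] using hm
      | cast t => simpa [snocIdx] using h2 t
    · induction b using Fin.lastCases with
      | last =>
        induction a using Fin.lastCases with
        | last => exact le_rfl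
        | cast a => simpa [snocIdx] using hle a
      | cast b =>
        induction a using Fin.lastCases with
        | last => exact absurd hab (by simp [Fin.le_def])
        | cast a => simpa [snocIdx] using h3 (by simpa using hab)
    · have : t = Fin.last K := by ext; simp; omega
      rw [this, snocIdx, Fin.snoc_last]
  · intro j hj
    obtain ⟨h1, h2, h3, h4⟩ := mem_vecIdx.1 hj
    have hlast : j (Fin.last K) = m := h4 _ (by simp)
    have hprev : prevIndex j (Fin.last K) ≤ m ∧ ∑ i, prevIndex j (Fin.last K) i = K ∧
        Fin.init j ∈ vecIdx K (prevIndex j (Fin.last K)) := by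
      rcases K with _ | K
      · exact ⟨by simp [prevIndex], by simp [prevIndex],
          mem_vecIdx.2 ⟨fun t => t.elim0, fun t => t.elim0, fun t => t.elim0, fun t => t.elim0⟩⟩
      · have hp : prevIndex j (Fin.last (K + 1)) = j (Fin.last K).castSucc := by
          rw [prevIndex, if_neg (by simp)]
          rfl
        refine ⟨hp ▸ h1 _, by rw [hp, h2]; simp, mem_vecIdx.2 ⟨fun t => ?_, fun t => ?_,
          fun a b hab => ?_, fun t ht => ?_⟩⟩
        · rw [hp]; exact h3 (Fin.castSucc_le_castSucc_iff.2 (Fin.le_last t))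
        · exact h2 t.castSucc
        · exact h3 (Fin.castSucc_le_castSucc_iff.2 hab)
        · have : t = Fin.last K := by ext; simp; omega
          rw [hp, this]; rfl
    obtain ⟨hp1, hp2, hp3⟩ := hprev
    obtain ⟨s, hs⟩ := exists_eq_add_single hp1 (by rw [hm, hp2])
    have hpos : stepPos j (Fin.last K) = s := stepPos_eq (by rw [hlast, ← hs])
    have hsub : m - Pi.single s 1 = prevIndex j (Fin.last K) := by
      rw [hs]; exact add_tsub_cancel_right _ _
    simp only [Finset.mem_sigma, support, Finset.mem_filter_univ, hpos, hsub]
    refine ⟨?_, hp3⟩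
    rw [hs]; simp
  · rintro ⟨s, j⟩ ha
    simp only [Finset.mem_sigma, support, Finset.mem_filter_univ] at ha
    have e1 := hpos s ha.1 j ha.2
    have e2 : Fin.init (snocIdx j m) = j := Fin.init_snoc (α := fun _ => Fin n → ℕ) (p := j) (x := m)
    simp only [e1]
    rw [e2]
  · intro j hj
    have hlast : j (Fin.last K) = m := (mem_vecIdx.1 hj).2.2.2 _ (by simp)
    show snocIdx (Fin.init j) m = j
    rw [snocIdx, ← hlast, Fin.snoc_init_self]
  · rintro ⟨s, j⟩ ha
    simp only [Finset.mem_sigma, support, Finset.mem_filter_univ] at ha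
    rw [hpos s ha.1 j ha.2]

end VectorIndices

/-! ### Order preserving relabellings of the support -/

section Relabel
variable {n : ℕ}

@[simp] lemma mem_support {v : Fin n → ℕ} {p : Fin n} : p ∈ support v ↔ v p ≠ 0 := by
  simp [support]

/-- `π⁻¹` preserves the order on the support of `m`. -/
def PreservesOrder (m : Fin n → ℕ) (π : Equiv.Perm (Fin n)) : Prop :=
  ∀ a b, m a ≠ 0 → m b ≠ 0 → a < b → π.symm a < π.symm b

variable {m : Fin n → ℕ} {π : Equiv.Perm (Fin n)}

lemma PreservesOrder.lt_iff (h : PreservesOrder m π) {a b : Fin n} (ha : m (π a) ≠ 0)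
    (hb : m (π b) ≠ 0) : π a < π b ↔ a < b := by
  have key : ∀ {a b : Fin n}, m (π a) ≠ 0 → m (π b) ≠ 0 → π a < π b → a < b := by
    intro a b ha hb hab
    simpa using h (π a) (π b) ha hb hab
  refine ⟨key ha hb, fun hab => ?_⟩
  by_contra hcon
  rcases (not_lt.1 hcon).lt_or_eq with h1 | h1
  · exact (key hb ha h1).asymm hab
  · exact hab.ne' (π.injective h1)

lemma depth_comp (m : Fin n → ℕ) (π : Equiv.Perm (Fin n)) : depth (m ∘ π) = depth m := by
  refine Finset.card_bij (fun p _ => π p) ?_ ?_ ?_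
  · intro p hp; simpa [support] using hp
  · intro a _ b _ hab; exact π.injective hab
  · intro b hb
    exact ⟨π.symm b, by simpa [support] using hb, by simp⟩

lemma PreservesOrder.rank_comp (h : PreservesOrder m π) {s : Fin n} (hs : m s ≠ 0) :
    rank (m ∘ π) (π.symm s) = rank m s := by
  refine Finset.card_bij (fun p _ => π p) ?_ ?_ ?_
  · intro p hp
    simp only [support, Finset.mem_filter, Finset.mem_univ, true_and, Function.comp] at hp ⊢
    refine ⟨hp.1, ?_⟩
    have := (h.lt_iff hp.1 (b := π.symm s) (by simpa using hs)).2 hp.2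
    simpa using this
  · intro a _ b _ hab; exact π.injective hab
  · intro b hb
    simp only [support, Finset.mem_filter, Finset.mem_univ, true_and, Function.comp] at hb ⊢
    exact ⟨π.symm b, ⟨by simpa using hb.1, h b s hb.1 hs hb.2⟩, by simp⟩

lemma formOf_congr {y y' : (Fin n → ℂ) → ℂ} {c c' : ℕ} {δ δ' : Fin 2} {b b' : Prop} [Decidable b]
    [Decidable b'] (hy : y = y') (hc : c = c') (hδ : δ = δ') (hb : b ↔ b') :
    formOf y c δ b = formOf y' c' δ' b' := by
  subst hy hc hδ
  funext x
  simp only [formOf, hb]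

lemma PreservesOrder.indexForm_comp (h : PreservesOrder m π) {s : Fin n} (hs : m s ≠ 0)
    (δ : Fin 2) : indexForm (m ∘ π) (π.symm s) δ
      = formOf (yCoord (m ∘ π) (rank m s)) (m s) δ (rank m s + 1 < depth m) := by
  exact formOf_congr (by rw [h.rank_comp hs]) (by simp) rfl (by rw [h.rank_comp hs, depth_comp])

lemma PreservesOrder.mem_laterSupport_comp (h : PreservesOrder m π) {s : Fin n} (hs : m s ≠ 0)
    (a : Fin n) : a ∈ laterSupport (m ∘ π) (π.symm s) ↔ π a ∈ laterSupport m s := by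
  simp only [laterSupport, support, Finset.mem_filter, Finset.mem_univ, true_and, Function.comp]
  refine and_congr_right fun ha => ?_
  rw [← h.lt_iff (by simpa using hs) ha, Equiv.apply_symm_apply]

/-- As the order on the support is kept, "the next nonzero position" commutes with the relabelling,
and the transpositions are conjugate. -/
lemma PreservesOrder.nextPerm_comp (h : PreservesOrder m π) {s : Fin n} (hs : m s ≠ 0) :
    nextPerm (m ∘ π) (π.symm s) = (π.symm * nextPerm m s) * π := by
  unfold nextPerm
  by_cases hc : m s = 1 ∧ (laterSupport m s).Nonempty
  · have hc' : (m ∘ π) (π.symm s) = 1 ∧ (laterSupport (m ∘ π) (π.symm s)).Nonempty := by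
      refine ⟨by simpa using hc.1, ?_⟩
      obtain ⟨a, ha⟩ := hc.2
      exact ⟨π.symm a, (h.mem_laterSupport_comp hs _).2 (by simpa using ha)⟩
    rw [dif_pos hc, dif_pos hc']
    have hmin : (laterSupport (m ∘ π) (π.symm s)).min' hc'.2
        = π.symm ((laterSupport m s).min' hc.2) := by
      have hmem := Finset.min'_mem _ hc.2
      refine le_antisymm (Finset.min'_le _ _ ((h.mem_laterSupport_comp hs _).2 (by simpa using hmem)))
        (Finset.le_min' _ _ _ fun b hb => ?_)
      have hb' := (h.mem_laterSupport_comp hs _).1 hb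
      rcases (Finset.min'_le _ _ hb').lt_or_eq with h1 | h1
      · have h2 := h _ _ (mem_support.1 (Finset.mem_filter.1 hmem).1)
          (mem_support.1 (Finset.mem_filter.1 hb').1) h1
        simpa using h2.le
      · rw [h1]; simp
    rw [hmin]
    ext1 p
    exact (DFunLike.congr_fun (Equiv.symm_trans_swap_trans s _ π.symm) p).symm
  · have hc' : ¬((m ∘ π) (π.symm s) = 1 ∧ (laterSupport (m ∘ π) (π.symm s)).Nonempty) := by
      rintro ⟨h1, a, ha⟩
      exact hc ⟨by simpa using h1, _, (h.mem_laterSupport_comp hs _).1 ha⟩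
    rw [dif_neg hc, dif_neg hc']
    ext1 p
    simp

/-- The permutation of a step, for both values of `δ`. -/
def deltaPerm (m : Fin n → ℕ) (s : Fin n) (δ : Fin 2) : Equiv.Perm (Fin n) :=
  if δ = 0 then 1 else nextPerm m s

lemma PreservesOrder.indexStep_comp (h : PreservesOrder m π) {s : Fin n} (hs : m s ≠ 0)
    (δ : Fin 2) : indexStep (m ∘ π) (π.symm s) δ
      = (m - Pi.single s 1) ∘ (deltaPerm m s δ * π : Equiv.Perm (Fin n)) := by
  have h1 : m ∘ π - Pi.single (π.symm s) 1 = (m - Pi.single s 1) ∘ π := by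
    funext p
    rcases eq_or_ne p (π.symm s) with rfl | hne
    · simp
    · have : π p ≠ s := fun hp => hne (by simp [← hp])
      simp [hne, this]
  unfold indexStep deltaPerm
  rw [h1, h.nextPerm_comp hs]
  split_ifs
  · rfl
  · funext p
    simp

/-- The value at the next nonzero position moves into `s`, which has just been emptied. No nonzero
position lies in between, so the order of the nonzero values is unchanged. This keeps the invariant
of the main induction alive. -/
lemma PreservesOrder.step (h : PreservesOrder m π) {s : Fin n} (hs : m s ≠ 0)
    (δ : Fin 2) : PreservesOrder (m - Pi.single s 1) (deltaPerm m s δ * π) := by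
  have hsub : ∀ a, (m - Pi.single s 1 : Fin n → ℕ) a ≠ 0 → m a ≠ 0 := fun a ha => by
    have : (m - Pi.single s 1 : Fin n → ℕ) a ≤ m a := Nat.sub_le _ _
    omega
  have hone : PreservesOrder (m - Pi.single s 1) π := fun a b ha hb hab =>
    h a b (hsub a ha) (hsub b hb) hab
  unfold deltaPerm
  split_ifs
  · exact hone
  · unfold nextPerm
    split_ifs with hc
    · set c := (laterSupport m s).min' hc.2
      have hcm : c ∈ laterSupport m s := Finset.min'_mem _ _
      have hmin : ∀ b, m b ≠ 0 → s < b → c ≤ b := fun b hb hsb =>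
        Finset.min'_le _ _ (by simp [laterSupport, support, hb, hsb])
      simp only [laterSupport, support, Finset.mem_filter, Finset.mem_univ, true_and] at hcm
      have hne : ∀ a, (m - Pi.single s 1 : Fin n → ℕ) a ≠ 0 → a ≠ s := by
        rintro a ha rfl
        simp [hc.1] at ha
      intro a b ha hb hab
      have hsymm : ∀ t, (Equiv.swap s c * π).symm t = π.symm (Equiv.swap s c t) := fun t => by
        simp [Equiv.symm_apply_eq]
      rw [hsymm, hsymm]
      have hsa := hne a ha
      have hsb := hne b hb
      have hma := hsub a ha
      have hmb := hsub b hb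
      rcases eq_or_ne a c with rfl | hac
      · rw [Equiv.swap_apply_right, Equiv.swap_apply_of_ne_of_ne hsb hab.ne']
        exact h _ _ hs hmb (hcm.2.trans hab)
      · rw [Equiv.swap_apply_of_ne_of_ne hsa hac]
        rcases eq_or_ne b c with rfl | hbc
        · rw [Equiv.swap_apply_right]
          refine h _ _ hma hs ?_
          by_contra hcon
          exact (hmin a hma (lt_of_le_of_ne (not_lt.1 hcon) hsa.symm)).not_gt hab
        · rw [Equiv.swap_apply_of_ne_of_ne hsb hbc]
          exact h _ _ hma hmb hab
    · exact hone

lemma PreservesOrder.one (m : Fin n → ℕ) : PreservesOrder m 1 := fun _ _ _ _ h => h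

end Relabel

/-! ### The iterated integrals as flat sections -/

section Main
variable {n : ℕ} [NeZero n]

lemma intervalIntegrable_fun_sum {ι : Type*} (s : Finset ι) {f : ι → ℝ → ℂ} {a b : ℝ}
    (h : ∀ i ∈ s, IntervalIntegrable (f i) MeasureTheory.volume a b) :
    IntervalIntegrable (fun t => ∑ i ∈ s, f i t) MeasureTheory.volume a b := by
  have := IntervalIntegrable.sum s h
  rwa [Finset.sum_fn] at this

/-- The 1-form `oneForm`, with the relabelling `π` applied after the transposition functions. -/
def relabelledForm (π : Equiv.Perm (Fin n)) {K : ℕ} (j : Fin K → Fin n → ℕ) (δ : Fin K → Fin 2)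
    (r : Fin K) : OneForm n :=
  formOf (yCoord (transposedIndex j δ r ∘ π) (stepRank j r)) (j r (stepPos j r)) (δ r)
    (stepRank j r + 1 < depth (j r))

section
variable {K : ℕ} {j : Fin K → Fin n → ℕ} {m : Fin n → ℕ} {s : Fin n} (hs : m s ≠ 0)
  (hm : ∑ i, m i = K + 1) (hj : j ∈ vecIdx K (m - Pi.single s 1))
include hs hm hj

lemma stepPos_snoc_last : stepPos (snocIdx j m) (Fin.last K) = s := by
  apply stepPos_eq
  rw [prevIndex_last (sum_sub_single hs hm) hj, snocIdx, Fin.snoc_last, sub_add_single hs]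

lemma relabelledForm_snoc_last {π : Equiv.Perm (Fin n)} (hπ : PreservesOrder m π)
    (δ : Fin K → Fin 2) (d : Fin 2) :
    relabelledForm π (snocIdx j m) (Fin.snoc (α := fun _ => Fin 2) δ d) (Fin.last K)
      = indexForm (m ∘ π) (π.symm s) d := by
  rw [hπ.indexForm_comp hs]
  have h1 : snocIdx j m (Fin.last K) = m := Fin.snoc_last ..
  have h2 : stepPos (snocIdx j m) (Fin.last K) = s := stepPos_snoc_last hs hm hj
  have h3 : stepRank (snocIdx j m) (Fin.last K) = rank m s := by rw [stepRank_eq_rank, h1, h2]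
  exact formOf_congr (by rw [transposedIndex_snoc_last, h3]) (by rw [h1, h2])
    (Fin.snoc_last (α := fun _ => Fin 2) ..) (by rw [h1, h3])

lemma relabelledForm_snoc_castSucc (π : Equiv.Perm (Fin n))
    (δ : Fin K → Fin 2) (d : Fin 2) (r : Fin K) :
    relabelledForm π (snocIdx j m) (Fin.snoc (α := fun _ => Fin 2) δ d) r.castSucc
      = relabelledForm (deltaPerm m s d * π) j δ r := by
  have h2 : snocIdx j m r.castSucc = j r := Fin.snoc_castSucc ..
  have h3 : stepRank (snocIdx j m) r.castSucc = stepRank j r := by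
    rw [stepRank_eq_rank, stepRank_eq_rank, stepPos_snoc, h2]
  have h1 : transposedIndex (snocIdx j m) (Fin.snoc (α := fun _ => Fin 2) δ d) r.castSucc ∘ π
      = transposedIndex j δ r ∘ (deltaPerm m s d * π : Equiv.Perm (Fin n)) := by
    rw [transposedIndex_snoc_castSucc, transposition, deltaPerm, stepPerm_eq_nextPerm,
      stepPos_snoc_last hs hm hj, snocIdx, Fin.snoc_last]
    split_ifs <;> rfl
  exact formOf_congr (by rw [h1, h3]) (by rw [h2, stepPos_snoc])
    (Fin.snoc_castSucc (α := fun _ => Fin 2) ..) (by rw [h2, h3])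

end

lemma sum_snoc {M : Type*} [AddCommMonoid M] {K : ℕ} (g : (Fin (K + 1) → Fin 2) → M) :
    ∑ δ, g δ = ∑ d : Fin 2, ∑ δ : Fin K → Fin 2, g (Fin.snoc (α := fun _ => Fin 2) δ d) := by
  rw [← Fintype.sum_prod_type']
  exact (Fintype.sum_equiv (Fin.snocEquiv fun _ => Fin 2) _ _ fun _ => rfl).symm

variable {γ : ℝ → Fin n → ℂ} (hγ : IsPiecewiseC1 γ) (hD : ∀ t ∈ Icc (0 : ℝ) 1, γ t ∈ polydisc n)
include hγ hD

/-- Induction on the weight. After a step with `δ = 1` the system asks for a permuted index, whereas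
the remaining vector indices end in the unpermuted `m - e_s`; the permutation `π` records this
discrepancy and is what makes the induction hypothesis applicable. The integrand is then the
differential of `indexFun` along the path. -/
theorem sum_iteratedIntegral_eq (K : ℕ) : ∀ (m : Fin n → ℕ), ∑ i, m i = K →
    ∀ π : Equiv.Perm (Fin n), PreservesOrder m π → ∀ b ∈ Icc (0 : ℝ) 1,
      ∑ δ : Fin K → Fin 2, ∑ j ∈ vecIdx K m,
        iteratedIntegral 0 K (fun i t => relabelledForm π j δ i (γ t) (deriv γ t)) b
      = indexFun (γ 0) (m ∘ π) (γ b) := by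
  induction K with
  | zero =>
    intro m hm π _ b _
    have hm0 : m = 0 := funext fun i => (Finset.sum_eq_zero_iff.1 hm) i (Finset.mem_univ i)
    have hv : vecIdx 0 m = Finset.univ := by
      ext j
      simp [mem_vecIdx, Monotone]
      exact Subsingleton.elim _ _
    rw [hv, hm0, Pi.zero_comp, indexFun_zero]
    simp [iteratedIntegral]
  | succ K ih =>
    intro m hm π hπ b hb
    have hint : ∀ (π' : Equiv.Perm (Fin n)) {K' : ℕ} (j : Fin K' → Fin n → ℕ) (δ : Fin K' → Fin 2) i,
        IntervalIntegrable (fun t => relabelledForm π' j δ i (γ t) (deriv γ t))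
          MeasureTheory.volume 0 1 := fun π' K' j δ i =>
      hγ.intervalIntegrable hD (continuousOn_formOf _ _ _ _ _)
    have hint2 : ∀ s ∈ support m, ∀ d, IntervalIntegrable
        (fun t => indexForm (m ∘ π) (π.symm s) d (γ t) (deriv γ t)) MeasureTheory.volume 0 1 :=
      fun s hs d => hγ.intervalIntegrable hD (continuousOn_formOf _ _ _ _ _)
    have hsub : uIcc 0 b ⊆ uIcc (0 : ℝ) 1 := by
      rw [uIcc_of_le hb.1, uIcc_of_le zero_le_one]; exact Icc_subset_Icc le_rfl hb.2
    have hprod : ∀ s ∈ support m, ∀ d, ∀ (δ : Fin K → Fin 2) (j : Fin K → Fin n → ℕ),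
        IntervalIntegrable (fun t => iteratedIntegral 0 K
          (fun i t => relabelledForm (deltaPerm m s d * π) j δ i (γ t) (deriv γ t)) t
            * indexForm (m ∘ π) (π.symm s) d (γ t) (deriv γ t)) MeasureTheory.volume 0 b :=
      fun s hs d δ j => by
        refine IntervalIntegrable.mono_set ?_ hsub
        refine (hint2 s hs d).continuousOn_mul ?_
        rw [uIcc_of_le zero_le_one]
        exact continuousOn_iteratedIntegral _ fun i => hint _ j δ i
    have h0 : γ 0 ∈ polydisc n := hD 0 (by simp)
    have hcont : ∀ s d, ContinuousOn (fun x => indexFun (γ 0) (indexStep (m ∘ π) s d) x •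
        indexForm (m ∘ π) s d x) (polydisc n) := fun s d =>
      ContinuousOn.smul (fun x hx => (hasFDerivAt_indexFun h0 _ hx).continuousAt.continuousWithinAt)
        (continuousOn_formOf _ _ _ _ _)
    have hint3 : ∀ s d, IntervalIntegrable (fun t => (indexFun (γ 0) (indexStep (m ∘ π) s d) (γ t) •
        indexForm (m ∘ π) s d (γ t)) (deriv γ t)) MeasureTheory.volume 0 b := fun s d =>
      (hγ.intervalIntegrable hD (hcont s d)).mono_set hsub
    have key : ∀ s ∈ support m, ∀ d, ∑ δ : Fin K → Fin 2, ∑ j ∈ vecIdx K (m - Pi.single s 1),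
        iteratedIntegral 0 (K + 1) (fun i t => relabelledForm π (snocIdx j m)
          (Fin.snoc (α := fun _ => Fin 2) δ d) i (γ t) (deriv γ t)) b
        = ∫ t in (0 : ℝ)..b, indexFun (γ 0) (indexStep (m ∘ π) (π.symm s) d) (γ t)
            * indexForm (m ∘ π) (π.symm s) d (γ t) (deriv γ t) := by
      intro s hs d
      have hms : m s ≠ 0 := mem_support.1 hs
      calc _ = ∑ δ : Fin K → Fin 2, ∑ j ∈ vecIdx K (m - Pi.single s 1),
            ∫ t in (0 : ℝ)..b, iteratedIntegral 0 K
              (fun i t => relabelledForm (deltaPerm m s d * π) j δ i (γ t) (deriv γ t)) t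
                * indexForm (m ∘ π) (π.symm s) d (γ t) (deriv γ t) := by
            refine Finset.sum_congr rfl fun δ _ => Finset.sum_congr rfl fun j hj => ?_
            rw [iteratedIntegral]
            simp only [relabelledForm_snoc_last hms hm hj hπ,
              relabelledForm_snoc_castSucc hms hm hj]
        _ = ∫ t in (0 : ℝ)..b, ∑ δ : Fin K → Fin 2, ∑ j ∈ vecIdx K (m - Pi.single s 1),
              iteratedIntegral 0 K
              (fun i t => relabelledForm (deltaPerm m s d * π) j δ i (γ t) (deriv γ t)) t
                * indexForm (m ∘ π) (π.symm s) d (γ t) (deriv γ t) := by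
            rw [intervalIntegral.integral_finsetSum]
            · refine Finset.sum_congr rfl fun δ _ => ?_
              rw [intervalIntegral.integral_finsetSum]
              exact fun j _ => hprod s hs d δ j
            · intro δ _
              exact intervalIntegrable_fun_sum _ fun j _ => hprod s hs d δ j
        _ = _ := by
            refine intervalIntegral.integral_congr fun t ht => ?_
            have ht1 : t ∈ Icc (0 : ℝ) 1 := by
              rw [← uIcc_of_le (zero_le_one (α := ℝ))]; exact hsub ht
            simp only [← Finset.sum_mul]
            rw [ih _ (sum_sub_single hms hm) _ (hπ.step hms d) t ht1, hπ.indexStep_comp hms]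
    calc _ = ∑ d : Fin 2, ∑ δ : Fin K → Fin 2, ∑ s ∈ support m,
          ∑ j ∈ vecIdx K (m - Pi.single s 1), iteratedIntegral 0 (K + 1)
            (fun i t => relabelledForm π (snocIdx j m)
              (Fin.snoc (α := fun _ => Fin 2) δ d) i (γ t) (deriv γ t)) b := by
          rw [sum_snoc]
          refine Finset.sum_congr rfl fun d _ => Finset.sum_congr rfl fun δ _ => ?_
          exact sum_vecIdx_succ hm fun _ j => iteratedIntegral 0 (K + 1)
            (fun i t => relabelledForm π j
              (Fin.snoc (α := fun _ => Fin 2) δ d) i (γ t) (deriv γ t)) b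
      _ = ∑ s ∈ support m, ∑ d : Fin 2, ∫ t in (0 : ℝ)..b,
            indexFun (γ 0) (indexStep (m ∘ π) (π.symm s) d) (γ t)
            * indexForm (m ∘ π) (π.symm s) d (γ t) (deriv γ t) := by
          rw [Finset.sum_congr rfl fun d _ => Finset.sum_comm, Finset.sum_comm]
          exact Finset.sum_congr rfl fun s hs => Finset.sum_congr rfl fun d _ => key s hs d
      _ = ∑ s ∈ support (m ∘ π), ∑ d : Fin 2, ∫ t in (0 : ℝ)..b,
            (indexFun (γ 0) (indexStep (m ∘ π) s d) (γ t) • indexForm (m ∘ π) s d (γ t))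
              (deriv γ t) := by
          refine Finset.sum_equiv π.symm (fun s => by simp) fun s _ => rfl
      _ = ∫ t in (0 : ℝ)..b, (∑ s ∈ support (m ∘ π), ∑ d,
            indexFun (γ 0) (indexStep (m ∘ π) s d) (γ t) • indexForm (m ∘ π) s d (γ t))
              (deriv γ t) := by
          simp only [sum_apply]
          rw [intervalIntegral.integral_finsetSum]
          · refine Finset.sum_congr rfl fun s _ => ?_
            rw [intervalIntegral.integral_finsetSum]
            exact fun d _ => hint3 s d
          · exact fun s _ => intervalIntegrable_fun_sum _ fun d _ => hint3 s d
      _ = _ := by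
          rw [hγ.integral_eq hD (ω := fun x => ∑ s ∈ support (m ∘ π), ∑ d,
              indexFun (γ 0) (indexStep (m ∘ π) s d) x • indexForm (m ∘ π) s d x)
            (continuousOn_finsetSum _ fun s _ => continuousOn_finsetSum _ fun d _ => hcont s d)
            (fun x hx => hasFDerivAt_indexFun h0 _ hx) hb, indexFun_base, sub_zero]
          intro h
          have : m = 0 := by
            funext i
            simpa using congrFun h (π.symm i)
          simp [this] at hm

theorem polylogPathIntegral_eq (m : Fin n → ℕ) :
    polylogPathIntegral m γ = indexFun (γ 0) m (γ 1) :=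
  sum_iteratedIntegral_eq hγ hD (weight m) m rfl 1 (PreservesOrder.one m) 1 (by simp)

end Main

/-! ### Series expansions -/

section Series

/-- The truncated nested sum `∑_{0 < k₁ < ⋯ < k_l < N} ∏ a i (k i)`. -/
def truncSum (a : ℕ → ℕ → ℂ) : ℕ → ℕ → ℂ
  | 0, _ => 1
  | l + 1, N => ∑ M ∈ Finset.Ico 1 N, a l M * truncSum a l M

/-- The increasing tuples of positive integers below `N`. -/
def incTuples (n N : ℕ) : Finset (Fin n → ℕ) :=
  open Classical in
  (Fintype.piFinset fun _ => Finset.range N).filter fun k => StrictMono k ∧ ∀ i, 0 < k i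

lemma mem_incTuples {n N : ℕ} {k : Fin n → ℕ} :
    k ∈ incTuples n N ↔ (∀ i, k i < N) ∧ StrictMono k ∧ ∀ i, 0 < k i := by
  simp [incTuples]

lemma sum_incTuples (a : ℕ → ℕ → ℂ) (n : ℕ) : ∀ N,
    ∑ k ∈ incTuples n N, ∏ i : Fin n, a i (k i) = truncSum a n N := by
  induction n with
  | zero =>
    intro N
    have : incTuples 0 N = {default} := by
      ext k
      simp only [mem_incTuples, Finset.mem_singleton, Subsingleton.elim k default, IsEmpty.forall_iff,
        true_and, and_true, iff_true]
      exact fun i => i.elim0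
    simp [this, truncSum]
  | succ n ih =>
    intro N
    rw [truncSum]
    simp only [← ih, Finset.mul_sum]
    rw [Finset.sum_sigma']
    refine Finset.sum_bij' (fun k _ => ⟨k (Fin.last n), Fin.init k⟩)
      (fun k _ => Fin.snoc (α := fun _ => ℕ) k.2 k.1) ?_ ?_ ?_ ?_ ?_
    · intro k hk
      obtain ⟨h1, h2, h3⟩ := mem_incTuples.1 hk
      simp only [Finset.mem_sigma, Finset.mem_Ico, mem_incTuples]
      exact ⟨⟨h3 _, h1 _⟩, fun i => h2 (Fin.castSucc_lt_last i),
        fun i j hij => h2 (Fin.castSucc_lt_castSucc_iff.2 hij), fun i => h3 _⟩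
    · rintro ⟨M, k⟩ hk
      simp only [Finset.mem_sigma, Finset.mem_Ico, mem_incTuples] at hk ⊢
      obtain ⟨⟨h1, h2⟩, h3, h4, h5⟩ := hk
      refine ⟨fun i => ?_, fun i j hij => ?_, fun i => ?_⟩
      · induction i using Fin.lastCases with
        | last => simpa using h2
        | cast i => simpa using (h3 i).trans h2
      · induction j using Fin.lastCases with
        | last =>
          induction i using Fin.lastCases with
          | last => exact absurd hij (lt_irrefl _)
          | cast i => simpa using h3 i
        | cast j =>
          induction i using Fin.lastCases with
          | last => exact absurd hij (Fin.le_last _).not_gt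
          | cast i => simpa using h4 (by simpa using hij)
      · induction i using Fin.lastCases with
        | last => simpa using Nat.pos_of_ne_zero (by omega)
        | cast i => simpa using h5 i
    · intro k _
      exact Fin.snoc_init_self k
    · rintro ⟨M, k⟩ _
      simp
    · intro k _
      rw [Fin.prod_univ_castSucc, mul_comm]
      rfl

lemma norm_truncSum_le {a : ℕ → ℕ → ℂ} (ha : ∀ l, Summable fun M => ‖a l M‖) (l : ℕ) :
    ∃ C, ∀ N, ‖truncSum a l N‖ ≤ C := by
  induction l with
  | zero => exact ⟨1, fun N => by simp [truncSum]⟩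
  | succ l ih =>
    obtain ⟨C, hC⟩ := ih
    have hC0 : 0 ≤ C := (norm_nonneg _).trans (hC 0)
    refine ⟨(∑' M, ‖a l M‖) * C, fun N => ?_⟩
    calc ‖truncSum a (l + 1) N‖ ≤ ∑ M ∈ Finset.Ico 1 N, ‖a l M‖ * C := by
          refine norm_sum_le_of_le _ fun M _ => ?_
          rw [norm_mul]
          exact mul_le_mul_of_nonneg_left (hC M) (norm_nonneg _)
      _ = (∑ M ∈ Finset.Ico 1 N, ‖a l M‖) * C := by rw [Finset.sum_mul]
      _ ≤ _ := mul_le_mul_of_nonneg_right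
          ((ha l).sum_le_tsum _ fun _ _ => norm_nonneg _) hC0

/-- The coefficients `X^M / M^μ`. -/
def polyCoeff (X : ℕ → ℂ) (μ : ℕ → ℕ) (l M : ℕ) : ℂ := X l ^ M / (M : ℂ) ^ μ l

lemma norm_inv_natCast_pow_le_one (M k : ℕ) : ‖((M : ℂ) ^ k)⁻¹‖ ≤ 1 := by
  rcases Nat.eq_zero_or_pos M with rfl | hM
  · rcases Nat.eq_zero_or_pos k with rfl | hk
    · simp
    · simp [hk.ne']
  · rw [norm_inv, norm_pow, Complex.norm_natCast]
    exact inv_le_one_of_one_le₀ (one_le_pow₀ (by exact_mod_cast hM))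

lemma norm_polyCoeff_le (X : ℕ → ℂ) (μ : ℕ → ℕ) (l M : ℕ) :
    ‖polyCoeff X μ l M‖ ≤ ‖X l‖ ^ M := by
  rw [polyCoeff, div_eq_mul_inv, norm_mul, norm_pow]
  exact mul_le_of_le_one_right (by positivity) (norm_inv_natCast_pow_le_one M _)

lemma summable_norm_polyCoeff {X : ℕ → ℂ} (hX : ∀ l, ‖X l‖ < 1) (μ : ℕ → ℕ) (l : ℕ) :
    Summable fun M => ‖polyCoeff X μ l M‖ :=
  (summable_geometric_of_lt_one (norm_nonneg _) (hX l)).of_nonneg_of_le (fun _ => norm_nonneg _)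
    (norm_polyCoeff_le X μ l)

/-- The series `∑ e_N w^N / N^k`. -/
def polyFun (e : ℕ → ℂ) (k : ℕ) (w : ℂ) : ℂ := ∑' N : ℕ, w ^ N / (N : ℂ) ^ k * e N

section
variable {e : ℕ → ℂ} {C : ℝ} (he : ∀ N, ‖e N‖ ≤ C) {w : ℂ} (hw : ‖w‖ < 1)
include he

lemma norm_polyFun_term_le (k N : ℕ) : ‖w ^ N / (N : ℂ) ^ k * e N‖ ≤ ‖w‖ ^ N * C := by
  rw [norm_mul, div_eq_mul_inv, norm_mul, norm_pow]
  exact mul_le_mul (mul_le_of_le_one_right (by positivity) (norm_inv_natCast_pow_le_one N _)) (he N)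
    (norm_nonneg _) (by positivity)

include hw

lemma summable_polyFun (k : ℕ) : Summable fun N : ℕ => w ^ N / (N : ℂ) ^ k * e N :=
  Summable.of_norm_bounded ((summable_geometric_of_lt_one (norm_nonneg _) hw).mul_right C)
    (norm_polyFun_term_le he k)

lemma summable_shift : Summable fun N : ℕ => w ^ N * e (N + 1) :=
  Summable.of_norm_bounded ((summable_geometric_of_lt_one (norm_nonneg _) hw).mul_right C)
    fun N => by
      rw [norm_mul, norm_pow]
      exact mul_le_mul_of_nonneg_left (he _) (by positivity)

lemma hasDerivAt_polyFun (k : ℕ) : HasDerivAt (polyFun e k)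
    (∑' N : ℕ, (N : ℂ) * w ^ (N - 1) / (N : ℂ) ^ k * e N) w := by
  -- On the ball of radius `r < 1` the termwise derivatives are dominated by `N r^(N-1) C`, which is
  -- summable.
  obtain ⟨r, hwr, hr⟩ := exists_between hw
  have hr0 : 0 ≤ r := (norm_nonneg w).trans hwr.le
  have hC0 : 0 ≤ C := (norm_nonneg _).trans (he 0)
  have hu : Summable fun N : ℕ => (N : ℝ) * r ^ (N - 1) * C := by
    refine Summable.mul_right C ?_
    rw [← summable_nat_add_iff 1]
    have h1 := (summable_pow_mul_geometric_of_norm_lt_one 1 (r := r) (by rwa [Real.norm_of_nonneg hr0])).add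
      (summable_geometric_of_lt_one hr0 hr)
    refine h1.congr fun N => ?_
    simp; ring
  refine hasDerivAt_tsum_of_isPreconnected (g := fun (N : ℕ) y => y ^ N / (N : ℂ) ^ k * e N)
    (g' := fun (N : ℕ) y => (N : ℂ) * y ^ (N - 1) / (N : ℂ) ^ k * e N)
    hu Metric.isOpen_ball (convex_ball (0 : ℂ) r).isPreconnected
    (fun N y _ => ?_) (fun N y hy => ?_) (y₀ := w) (by simpa using hwr) (summable_polyFun he hw k)
    (by simpa using hwr)
  · exact ((hasDerivAt_pow N y).div_const _).mul_const _
  · have hy' : ‖y‖ ≤ r := by simpa using (mem_ball_zero_iff.1 hy).le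
    rw [norm_mul, div_eq_mul_inv, norm_mul, norm_mul, norm_pow, Complex.norm_natCast]
    refine mul_le_mul ?_ (he N) (norm_nonneg _) (by positivity)
    refine (mul_le_of_le_one_right (by positivity) (norm_inv_natCast_pow_le_one N _)).trans ?_
    gcongr

lemma hasDerivAt_polyFun_add_two (hw0 : w ≠ 0) (k : ℕ) :
    HasDerivAt (polyFun e (k + 2)) (1 / w * polyFun e (k + 1) w) w := by
  convert hasDerivAt_polyFun he hw (k + 2) using 1
  rw [polyFun, ← tsum_mul_left]
  refine tsum_congr fun N => ?_
  rcases N with _ | N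
  · simp
  · have : ((N + 1 : ℕ) : ℂ) ≠ 0 := Nat.cast_ne_zero.2 N.succ_ne_zero
    rw [Nat.add_sub_cancel]
    field_simp
    ring

lemma hasDerivAt_polyFun_one :
    HasDerivAt (polyFun e 1) (∑' N : ℕ, w ^ N * e (N + 1)) w := by
  have h := hasDerivAt_polyFun he hw 1
  have h1 : ∀ N : ℕ, ((N + 1 : ℕ) : ℂ) * w ^ (N + 1 - 1) / ((N + 1 : ℕ) : ℂ) ^ 1 * e (N + 1)
      = w ^ N * e (N + 1) := fun N => by
    have : ((N + 1 : ℕ) : ℂ) ≠ 0 := Nat.cast_ne_zero.2 N.succ_ne_zero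
    rw [Nat.add_sub_cancel, pow_one]
    field_simp
  have h2 : Summable fun N : ℕ => (N : ℂ) * w ^ (N - 1) / (N : ℂ) ^ 1 * e N := by
    rw [← summable_nat_add_iff 1]
    exact (summable_shift he hw).congr fun N => (h1 N).symm
  rw [h2.tsum_eq_zero_add, tsum_congr h1] at h
  simpa using h

end

variable {X : ℕ → ℂ} (hX : ∀ l, ‖X l‖ < 1) {μ : ℕ → ℕ} (hμ : ∀ l, 1 ≤ μ l) {w : ℂ} (hw : ‖w‖ < 1)
include hX hw

lemma hasDerivAt_polyFun_truncSum_zero :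
    HasDerivAt (polyFun (truncSum (polyCoeff X μ) 0) 1) (1 / (1 - w)) w := by
  obtain ⟨C, hC⟩ := norm_truncSum_le (summable_norm_polyCoeff hX μ) 0
  convert hasDerivAt_polyFun_one hC hw using 1
  simp only [truncSum, mul_one]
  rw [tsum_geometric_of_norm_lt_one hw, one_div]

include hμ

/-- Abel summation: consecutive truncated sums differ by one summand, so `(1 - w) ∑ e_{N+1} w^N` is
a series of depth one less, at the argument `w X_l`. -/
lemma hasDerivAt_polyFun_truncSum_succ (l : ℕ) :
    HasDerivAt (polyFun (truncSum (polyCoeff X μ) (l + 1)) 1)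
      (1 / (1 - w) * polyFun (truncSum (polyCoeff X μ) l) (μ l) (w * X l)) w := by
  set e := truncSum (polyCoeff X μ) (l + 1) with he
  obtain ⟨C, hC⟩ := norm_truncSum_le (summable_norm_polyCoeff hX μ) (l + 1)
  convert hasDerivAt_polyFun_one hC hw using 1
  have h1w : 1 - w ≠ 0 := sub_ne_zero.2 fun h => by simp [← h] at hw
  have hs := summable_shift hC hw
  have hdiff : ∀ N : ℕ, (w * X l) ^ N / (N : ℂ) ^ μ l * truncSum (polyCoeff X μ) l N
      = w ^ N * e (N + 1) - w ^ N * e N := fun N => by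
    rcases N with _ | N
    · have := hμ l
      simp [he, truncSum, show μ l ≠ 0 by omega]
    · rw [← mul_sub, he, truncSum, truncSum, Finset.sum_Ico_succ_top (by omega), add_sub_cancel_left,
        polyCoeff, mul_pow]
      ring
  have hs2 : Summable fun N : ℕ => w ^ N * e N := by
    simpa using summable_polyFun hC hw 0
  have hshift : ∑' N : ℕ, w ^ N * e N = w * ∑' N : ℕ, w ^ N * e (N + 1) := by
    rw [hs2.tsum_eq_zero_add, ← tsum_mul_left]
    simp only [he, truncSum, pow_succ]
    simp [mul_left_comm, mul_assoc]
  rw [polyFun, tsum_congr hdiff, hs.tsum_sub hs2, hshift]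
  field_simp
  rw [he]
  ring

end Series

/-! ### Absolute convergence of the series -/

section Li
variable {n : ℕ} {m : Fin n → ℕ} {x : Fin n → ℂ} (hx : ∀ i, ‖x i‖ < 1)

lemma norm_liTerm_le (m : Fin n → ℕ) (x : Fin n → ℂ) (k : SumRange n) :
    ‖liTerm m x k‖ ≤ ∏ i, ‖x i‖ ^ k.1 i := by
  rw [liTerm, norm_prod]
  refine Finset.prod_le_prod (fun _ _ => norm_nonneg _) fun i _ => ?_
  rw [div_eq_mul_inv, norm_mul, norm_pow]
  exact mul_le_of_le_one_right (by positivity) (norm_inv_natCast_pow_le_one _ _)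

include hx

lemma summable_prod_pow : Summable fun k : Fin n → ℕ => ∏ i, ‖x i‖ ^ k i := by
  refine summable_of_sum_le (c := ∏ i, (1 - ‖x i‖)⁻¹) (fun k => by positivity) fun u => ?_
  -- A finite set of exponents lies in a box, over which the sum factors into partial geometric
  -- sums.
  obtain ⟨N, hN⟩ : ∃ N : ℕ, u ⊆ Fintype.piFinset fun _ => Finset.range N := by
    refine ⟨u.sup (fun k => Finset.univ.sup k) + 1, fun k hk => ?_⟩
    rw [Fintype.mem_piFinset]
    intro i
    rw [Finset.mem_range, Nat.lt_succ_iff]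
    exact (Finset.le_sup (f := k) (Finset.mem_univ i)).trans
      (Finset.le_sup (f := fun k : Fin n → ℕ => Finset.univ.sup k) hk)
  refine (Finset.sum_le_sum_of_subset_of_nonneg hN fun k _ _ => by positivity).trans ?_
  rw [← Finset.prod_univ_sum (fun _ => Finset.range N) fun i M => ‖x i‖ ^ M]
  refine Finset.prod_le_prod (fun i _ => by positivity) fun i _ => ?_
  rw [← tsum_geometric_of_lt_one (norm_nonneg _) (hx i)]
  exact (summable_geometric_of_lt_one (norm_nonneg _) (hx i)).sum_le_tsum _ fun _ _ => by positivity

lemma summable_liTerm (m : Fin n → ℕ) : Summable (liTerm m x) :=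
  Summable.of_norm_bounded ((summable_prod_pow hx).comp_injective Subtype.val_injective)
    (norm_liTerm_le m x)

end Li

/-- Both sides are the limit of the truncated nested sums: the left one by exhausting the range with
the boxes `k_i < N`, the right one through partial sums in the outermost variable. -/
lemma Li_eq_polyFun {n : ℕ} {m : Fin (n + 1) → ℕ} {x : Fin (n + 1) → ℂ} (hx : ∀ i, ‖x i‖ < 1)
    {X : ℕ → ℂ} {μ : ℕ → ℕ} (hX : ∀ l, ‖X l‖ < 1) (hμ : ∀ l, 1 ≤ μ l)
    (hxX : ∀ i, x i = X i) (hmμ : ∀ i, m i = μ i) :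
    Li m x = polyFun (truncSum (polyCoeff X μ) n) (μ n) (X n) := by
  classical
  obtain ⟨C, hC⟩ := norm_truncSum_le (summable_norm_polyCoeff hX μ) n
  have h1 : Tendsto (fun N => truncSum (polyCoeff X μ) (n + 1) N) atTop (𝓝 (Li m x)) := by
    have h := (summable_liTerm hx m).hasSum
    have hS : Tendsto (fun N : ℕ => (Fintype.piFinset fun _ : Fin (n + 1) => Finset.range N).subtype
        fun k => StrictMono k ∧ ∀ i, 0 < k i) atTop atTop := by
      refine tendsto_atTop_finset_of_monotone (fun N N' hN k hk => ?_) fun k => ?_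
      · simp only [Finset.mem_subtype, Fintype.mem_piFinset, Finset.mem_range] at hk ⊢
        exact fun i => (hk i).trans_le hN
      · refine ⟨Finset.univ.sup k.1 + 1, ?_⟩
        simp only [Finset.mem_subtype, Fintype.mem_piFinset, Finset.mem_range, Nat.lt_succ_iff]
        exact fun i => Finset.le_sup (f := k.1) (Finset.mem_univ i)
    refine (h.comp hS).congr fun N => ?_
    rw [← sum_incTuples, Function.comp]
    have h2 := Finset.sum_subtype_eq_sum_filter (s := Fintype.piFinset fun _ : Fin (n + 1) => Finset.range N)
      (p := fun k => StrictMono k ∧ ∀ i, 0 < k i) (fun k => ∏ i : Fin (n + 1), polyCoeff X μ i (k i))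
    rw [incTuples]
    convert h2 using 2 with k
    · exact Finset.prod_congr rfl fun i _ => by rw [polyCoeff, hxX, hmμ]
  refine tendsto_nhds_unique h1 ?_
  have h2 := (summable_polyFun hC (hX n) (μ n)).hasSum.tendsto_sum_nat
  refine h2.congr fun N => ?_
  rw [truncSum]
  rcases N with _ | N
  · simp
  · rw [Finset.range_eq_Ico, Finset.sum_eq_sum_Ico_succ_bot (by omega)]
    have := hμ n
    simp [show μ n ≠ 0 by omega, polyCoeff]

/-! ### Bounds for the 1-forms -/

section FormBounds
variable {n : ℕ}

lemma segProd_succ {l : ℕ} (hl : l < n) (z : Fin n → ℂ) :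
    segProd n l n z = z ⟨l, hl⟩ * segProd n (l + 1) n z := by
  have h : Finset.univ.filter (fun α : Fin n => l ≤ α.val ∧ α.val < n)
      = insert ⟨l, hl⟩ (Finset.univ.filter (fun α : Fin n => l + 1 ≤ α.val ∧ α.val < n)) := by
    ext α
    simp only [Finset.mem_filter_univ, Finset.mem_insert, Fin.ext_iff]
    omega
  rw [segProd, h, Finset.prod_insert (by simp)]
  rfl

lemma fderiv_segProd {x : Fin n → ℂ} (hx : x ∈ polydisc n) (p q : ℕ) (u : Fin n → ℂ) :
    fderiv ℂ (segProd n p q) x u = segProd n p q x *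
      ∑ α ∈ Finset.univ.filter (fun α : Fin n => p ≤ α.val ∧ α.val < q), u α / x α := by
  unfold segProd
  rw [fderiv_finsetProd fun i _ => by fun_prop, sum_apply, Finset.mul_sum]
  refine Finset.sum_congr rfl fun α hα => ?_
  have h1 : fderiv ℂ (fun y : Fin n → ℂ => y α) x = ContinuousLinearMap.proj α :=
    (ContinuousLinearMap.proj (R := ℂ) (φ := fun _ : Fin n => ℂ) α).fderiv
  rw [h1, ← Finset.mul_prod_erase _ _ hα, smul_apply]
  have := ne_zero_of_mem_polydisc hx α
  simp only [ContinuousLinearMap.proj_apply, smul_eq_mul]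
  field_simp

lemma norm_segProd_le {x : Fin n → ℂ} {ρ : ℝ} (hρ : ρ < 1) (hxρ : ∀ j, ‖x j‖ ≤ ρ)
    {p q : ℕ} {j : Fin n} (hj : p ≤ j.val ∧ j.val < q) : ‖segProd n p q x‖ ≤ ‖x j‖ := by
  have hmem : j ∈ Finset.univ.filter (fun α : Fin n => p ≤ α.val ∧ α.val < q) := by simpa using hj
  rw [segProd, norm_prod, ← Finset.mul_prod_erase _ _ hmem]
  exact mul_le_of_le_one_right (norm_nonneg _)
    (Finset.prod_le_one (fun _ _ => norm_nonneg _) fun i _ => (hxρ i).trans hρ.le)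

lemma exists_yCoord_eq {v : Fin n → ℕ} {s : Fin n} (hs : v s ≠ 0) :
    ∃ q, s.val < q ∧ yCoord v (rank v s) = segProd n s q ∧
      (∀ t, s < t → v t ≠ 0 → q ≤ t.val) := by
  obtain ⟨L, L', h⟩ := List.append_of_mem (List.mem_finRange s)
  refine ⟨_, lt_next h, yCoord_rank h hs, fun t ht hvt => ?_⟩
  have hmem : t ∈ L'.filter (fun p => v p ≠ 0) :=
    List.mem_filter.2 ⟨(mem_right_iff h).2 ht, by simpa using hvt⟩
  have hsorted : (L'.filter (fun p => v p ≠ 0)).Pairwise (· < ·) := by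
    have := (List.sortedLT_finRange n).pairwise
    rw [h, List.pairwise_append, List.pairwise_cons] at this
    exact this.2.1.2.filter _
  rcases hf : L'.filter (fun p => v p ≠ 0) with _ | ⟨a, r⟩
  · rw [hf] at hmem; simp at hmem
  · rw [hf] at hmem hsorted
    rcases List.mem_cons.1 hmem with rfl | h1
    · simp
    · simpa using ((List.pairwise_cons.1 hsorted).1 t h1).le

section LastPosition
variable {v : Fin n → ℕ} {s : Fin n} (hs : v s ≠ 0) (hlast : ∀ t, s < t → v t = 0)
include hs hlast

lemma yCoord_last : yCoord v (rank v s) = segProd n s n := by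
  obtain ⟨L, L', h⟩ := List.append_of_mem (List.mem_finRange s)
  have hf : L'.filter (fun p => v p ≠ 0) = [] := by
    rw [List.filter_eq_nil_iff]
    intro t ht
    simp [hlast t ((mem_right_iff h).1 ht)]
  rw [yCoord_rank h hs, hf]
  rfl

lemma indexForm_last_one : indexForm v s 1 = fun _ => 0 := by
  obtain ⟨L, L', h⟩ := List.append_of_mem (List.mem_finRange s)
  have hf : L'.filter (fun p => v p ≠ 0) = [] := by
    rw [List.filter_eq_nil_iff]
    intro t ht
    simp [hlast t ((mem_right_iff h).1 ht)]
  have hd : ¬(rank v s + 1 < depth v) := by rw [depth_eq_length h hs, hf]; simp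
  funext x
  rw [indexForm, formOf]
  simp [hd]

end LastPosition

lemma norm_fderiv_segProd_le {x : Fin n → ℂ} (hx : x ∈ polydisc n) (p q : ℕ) (u : Fin n → ℂ) :
    ‖fderiv ℂ (segProd n p q) x u‖ ≤ ‖segProd n p q x‖ * ∑ j, ‖u j‖ / ‖x j‖ := by
  rw [fderiv_segProd hx, norm_mul]
  refine mul_le_mul_of_nonneg_left ((norm_sum_le _ _).trans ?_) (norm_nonneg _)
  simp only [norm_div]
  exact Finset.sum_le_sum_of_subset_of_nonneg (Finset.subset_univ _) fun _ _ _ => by positivity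

lemma norm_one_div_one_sub_le {ρ : ℝ} (hρ : ρ < 1) {y : ℂ} (hy : ‖y‖ ≤ ρ) : ‖1 / (1 - y)‖ ≤ 1 / (1 - ρ) := by
  rw [norm_div, norm_one]
  refine one_div_le_one_div_of_le (by linarith) ?_
  have := norm_sub_norm_le (1 : ℂ) y
  rw [norm_one] at this
  linarith

section Bound
variable {x : Fin n → ℂ} (hx : x ∈ polydisc n) {ρ : ℝ} (hρ : ρ < 1) (hxρ : ∀ j, ‖x j‖ ≤ ρ)
include hx hρ hxρ

/-- Since `dy = y ∑ dx_α / x_α`, the factor `1 / y` is always cancelled, and `|1 - y| ≥ 1 - ρ`: all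
the forms have at most logarithmic poles along `x_j = 0`. -/
lemma norm_indexForm_le {v : Fin n → ℕ} {s : Fin n} (hs : v s ≠ 0) (δ : Fin 2) (u : Fin n → ℂ) :
    ‖indexForm v s δ x u‖ ≤ 1 / (1 - ρ) * ∑ j, ‖u j‖ / ‖x j‖ := by
  obtain ⟨q, hq, hy, -⟩ := exists_yCoord_eq hs
  have hρ0 : 0 ≤ ρ := (norm_nonneg _).trans (hxρ s)
  have hyn : ‖segProd n s q x‖ ≤ ρ := (norm_segProd_le hρ hxρ ⟨le_rfl, hq⟩).trans (hxρ s)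
  have hy0 : 0 < ‖segProd n s q x‖ := norm_pos_iff.2 (segProd_ne_zero hx _ _)
  set S := ∑ j, ‖u j‖ / ‖x j‖
  have hS : 0 ≤ S := Finset.sum_nonneg fun _ _ => by positivity
  have hd := norm_fderiv_segProd_le hx s q u
  have h1 : (1 : ℝ) ≤ 1 / (1 - ρ) := by rw [le_div_iff₀ (by linarith)]; linarith
  have hnn : 0 ≤ 1 / (1 - ρ) * S := by positivity
  rw [indexForm, formOf, hy]
  split_ifs
  · rw [smul_apply, norm_smul, norm_div, norm_one]
    calc 1 / ‖segProd n s q x‖ * _ ≤ 1 / ‖segProd n s q x‖ * (‖segProd n s q x‖ * S) := by gcongr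
      _ = 1 * S := by field_simp
      _ ≤ _ := by gcongr
  · simpa using hnn
  · rw [smul_apply, norm_smul]
    calc _ ≤ 1 / (1 - ρ) * (‖segProd n s q x‖ * S) := by
          gcongr; exact norm_one_div_one_sub_le hρ hyn
      _ ≤ 1 / (1 - ρ) * (1 * S) := by gcongr; linarith
      _ = _ := by rw [one_mul]
  · rw [smul_apply, norm_smul, norm_div, norm_mul, norm_one]
    have h2 : ‖segProd n s q x - 1‖⁻¹ ≤ 1 / (1 - ρ) := by
      have := norm_one_div_one_sub_le hρ hyn
      rwa [norm_div, norm_one, norm_sub_rev, one_div] at this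
    calc _ ≤ 1 / (‖segProd n s q x‖ * ‖segProd n s q x - 1‖) * (‖segProd n s q x‖ * S) := by gcongr
      _ = ‖segProd n s q x - 1‖⁻¹ * S := by field_simp
      _ ≤ _ := by gcongr
  · simpa using hnn

/-- At the last nonzero position `y` contains every `x_j` with `j ≥ s`, and `dy / (1 - y)` has no
pole at `y = 0`, so a factor `‖x j‖` is gained. This is the source of the smallness on the first
leg. -/
lemma norm_indexForm_last_le {v : Fin n → ℕ} {s : Fin n} (hs : v s = 1)
    (hlast : ∀ t, s < t → v t = 0) (δ : Fin 2) (u : Fin n → ℂ) {j : Fin n} (hj : s ≤ j) :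
    ‖indexForm v s δ x u‖ ≤ ‖x j‖ * (1 / (1 - ρ) * ∑ j, ‖u j‖ / ‖x j‖) := by
  have hρ0 : 0 ≤ ρ := (norm_nonneg _).trans (hxρ s)
  have hs0 : v s ≠ 0 := by omega
  set S := ∑ j, ‖u j‖ / ‖x j‖
  have hS : 0 ≤ S := Finset.sum_nonneg fun _ _ => by positivity
  have hp : 0 < 1 - ρ := by linarith
  fin_cases δ
  · have hyj : ‖segProd n s n x‖ ≤ ‖x j‖ := norm_segProd_le hρ hxρ ⟨hj, j.2⟩
    have hd := norm_fderiv_segProd_le hx s n u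
    have h1 := norm_one_div_one_sub_le hρ (hyj.trans (hxρ j))
    change ‖indexForm v s 0 x u‖ ≤ _
    rw [indexForm, formOf, yCoord_last hs0 hlast, if_neg (by omega), if_pos rfl, smul_apply, norm_smul]
    calc _ ≤ 1 / (1 - ρ) * (‖x j‖ * S) := by
          gcongr
          exact hd.trans (by gcongr)
      _ = _ := by ring
  · change ‖indexForm v s 1 x u‖ ≤ _
    rw [indexForm_last_one hs0 hlast]
    simp only [zero_apply, norm_zero]
    positivity

end Bound

end FormBounds

/-! ### Straight paths from the diagonal -/

/-- Comparison with `B log (t + e)`: one integration costs one logarithm. -/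
lemma norm_le_add_log {f f' : ℝ → ℂ} {e A B : ℝ} (he : 0 < e)
    (hf : ∀ t ∈ Icc (0 : ℝ) 1, HasDerivAt f (f' t) t) (h0 : ‖f 0‖ ≤ A) (hB : 0 ≤ B)
    (hf' : ∀ t ∈ Icc (0 : ℝ) 1, ‖f' t‖ ≤ B / (t + e)) {t : ℝ} (ht : t ∈ Icc (0 : ℝ) 1) :
    ‖f t‖ ≤ A + B * Real.log ((1 + e) / e) := by
  have h := image_norm_le_of_norm_deriv_right_le_deriv_boundary' (a := 0) (b := 1)
    (B := fun t => A + B * (Real.log (t + e) - Real.log e)) (B' := fun t => B / (t + e))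
    (fun s hs => (hf s hs).continuousAt.continuousWithinAt)
    (fun s hs => (hf s (Ico_subset_Icc_self hs)).hasDerivWithinAt)
    (by simpa using h0) ?_ ?_ (fun s hs => hf' s (Ico_subset_Icc_self hs)) ht
  · refine h.trans ?_
    rw [Real.log_div (by linarith) he.ne']
    have := Real.log_le_log (by linarith [ht.1]) (show t + e ≤ 1 + e by linarith [ht.2])
    gcongr
  · intro s hs
    have : s + e ≠ 0 := by linarith [hs.1]
    fun_prop (disch := assumption)
  · intro s hs
    have : s + e ≠ 0 := by linarith [hs.1]
    have h1 : HasDerivAt (fun t => Real.log (t + e)) (1 / (s + e)) s :=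
      ((hasDerivAt_id s).add_const e).log this
    have h2 := ((h1.sub_const (Real.log e)).const_mul B).const_add A
    exact (h2.congr_deriv (by ring)).hasDerivWithinAt

/-- The straight path from `p` to `q`. -/
def legPath {n : ℕ} (p q : Fin n → ℂ) (t : ℝ) : Fin n → ℂ := fun j => p j + t * (q j - p j)

section Legs
variable {n : ℕ} {p q : Fin n → ℂ}

lemma hasDerivAt_legPath (p q : Fin n → ℂ) (t : ℝ) :
    HasDerivAt (legPath p q) (fun j => q j - p j) t := by
  rw [hasDerivAt_pi]
  intro j
  have h : HasDerivAt (fun t : ℝ => (t : ℂ)) 1 t := Complex.ofRealCLM.hasDerivAt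
  have h1 := (h.mul_const (q j - p j)).const_add (p j)
  rwa [one_mul] at h1

@[simp] lemma legPath_zero : legPath p q 0 = p := by funext j; simp [legPath]

@[simp] lemma legPath_one : legPath p q 1 = q := by funext j; simp [legPath]

lemma legPath_eq_lineMap (t : ℝ) : legPath p q t = AffineMap.lineMap p q t := by
  funext j
  simp [legPath, AffineMap.lineMap_apply, add_comm]

lemma legPath_mem (hp : p ∈ polydisc n) (hq : q ∈ polydisc n) {t : ℝ} (ht : t ∈ Icc (0 : ℝ) 1) :
    legPath p q t ∈ polydisc n := by
  rw [legPath_eq_lineMap]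
  exact convex_polydisc.lineMap_mem hp hq ht

lemma norm_legPath_le {ρ : ℝ} (hp : ∀ j, ‖p j‖ ≤ ρ) (hq : ∀ j, ‖q j‖ ≤ ρ) {t : ℝ}
    (ht : t ∈ Icc (0 : ℝ) 1) (j : Fin n) : ‖legPath p q t j‖ ≤ ρ := by
  have h1 : p j ∈ Metric.closedBall (0 : ℂ) ρ := by simpa using hp j
  have h2 : q j ∈ Metric.closedBall (0 : ℂ) ρ := by simpa using hq j
  have := (convex_closedBall (0 : ℂ) ρ).lineMap_mem h1 h2 ht
  have h3 : legPath p q t j = AffineMap.lineMap (p j) (q j) t := by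
    simp [legPath, AffineMap.lineMap_apply, add_comm]
  simpa [h3] using this

lemma sum_legPath_le (hp : p ∈ polydisc n) (hq : q ∈ polydisc n) {e r : ℝ} (he : 0 < e)
    (hr : 0 < r) (hr1 : r ≤ 1) (hpq : ∀ j, p j = q j ∨ (‖p j‖ = e ∧ r ≤ (q j).re)) {t : ℝ}
    (ht : t ∈ Icc (0 : ℝ) 1) :
    ∑ j, ‖q j - p j‖ / ‖legPath p q t j‖ ≤ (3 * n / r) / (t + e) := by
  have key : ∀ j, ‖q j - p j‖ / ‖legPath p q t j‖ ≤ (3 / r) / (t + e) := by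
    intro j
    have hte : 0 < t + e := by linarith [ht.1]
    rcases hpq j with h | ⟨h1, h2⟩
    · rw [h, sub_self, norm_zero, zero_div]; positivity
    · have hz : 0 < ‖legPath p q t j‖ :=
        norm_pos_iff.2 (ne_zero_of_mem_polydisc (legPath_mem hp hq ht) j)
      have hd : ‖q j - p j‖ ≤ 1 := by
        have := norm_sub_le (q j - 1 / 2) (p j - 1 / 2)
        rw [sub_sub_sub_cancel_right] at this
        linarith [hq j, hp j]
      have hre : t * r ≤ ‖legPath p q t j‖ := by
        refine le_trans ?_ (Complex.re_le_norm _)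
        have h3 : (legPath p q t j).re = (1 - t) * (p j).re + t * (q j).re := by
          simp [legPath]; ring
        rw [h3]
        have := re_pos_of_mem_polydisc hp j
        nlinarith [ht.1, ht.2, mul_nonneg (sub_nonneg.2 ht.2) this.le, mul_le_mul_of_nonneg_left h2 ht.1]
      have hlow : e - t ≤ ‖legPath p q t j‖ := by
        have h3 : ‖(t : ℂ) * (q j - p j)‖ ≤ t := by
          rw [norm_mul, Complex.norm_real, Real.norm_of_nonneg ht.1]
          exact mul_le_of_le_one_right ht.1 hd
        have h4 := norm_sub_norm_le (p j) (-((t : ℂ) * (q j - p j)))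
        rw [sub_neg_eq_add, norm_neg] at h4
        have h5 : legPath p q t j = p j + t * (q j - p j) := rfl
        rw [h5]; linarith
      rw [div_div, div_le_div_iff₀ hz (by positivity)]
      -- Write `r (t + e) = 2 t r + r (e - t)` and use `r ≤ 1` with the two lower bounds; hence the
      -- constant 3.
      have h6 : r * (t + e) ≤ 3 * ‖legPath p q t j‖ := by nlinarith
      calc ‖q j - p j‖ * (r * (t + e)) ≤ 1 * (r * (t + e)) := by gcongr
        _ ≤ _ := by linarith
  calc _ ≤ ∑ _j : Fin n, (3 / r) / (t + e) := Finset.sum_le_sum fun j _ => key j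
    _ = _ := by simp; ring

lemma hasDerivAt_comp_legPath {F : (Fin n → ℂ) → ℂ} {F' : (Fin n → ℂ) →L[ℂ] ℂ} {t : ℝ}
    (hF : HasFDerivAt F F' (legPath p q t)) :
    HasDerivAt (fun t => F (legPath p q t)) (F' fun j => q j - p j) t :=
  (hF.restrictScalars ℝ).comp_hasDerivAt t (hasDerivAt_legPath p q t)

end Legs

/-! ### The flat section near the diagonal -/

section FirstLeg
variable {n : ℕ}

lemma sum_indexStep {v : Fin n → ℕ} {s : Fin n} (hs : v s ≠ 0) {K : ℕ} (hv : ∑ i, v i = K + 1)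
    (δ : Fin 2) : ∑ i, indexStep v s δ i = K := by
  have h := sum_sub_single hs hv
  unfold indexStep
  split_ifs
  · exact h
  · rwa [Equiv.sum_comp (nextPerm v s) (v - Pi.single s 1 : Fin n → ℕ)]

lemma log_ratio_nonneg {e : ℝ} (he : 0 < e) : 0 ≤ Real.log ((1 + e) / e) :=
  Real.log_nonneg (by rw [le_div_iff₀ he]; linarith)

lemma norm_indexForm_legPath_le {p q : Fin n → ℂ} (hp : p ∈ polydisc n) (hq : q ∈ polydisc n)
    {e r ρ : ℝ} (he : 0 < e) (hr : 0 < r) (hr1 : r ≤ 1)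
    (hpq : ∀ j, p j = q j ∨ (‖p j‖ = e ∧ r ≤ (q j).re)) (hρ : ρ < 1)
    (hpρ : ∀ j, ‖p j‖ ≤ ρ) (hqρ : ∀ j, ‖q j‖ ≤ ρ) {v : Fin n → ℕ} {s : Fin n} (hs : v s ≠ 0)
    (δ : Fin 2) {t : ℝ} (ht : t ∈ Icc (0 : ℝ) 1) :
    ‖indexForm v s δ (legPath p q t) fun j => q j - p j‖
      ≤ (1 / (1 - ρ) * (3 * n / r)) / (t + e) := by
  have h1 := norm_indexForm_le (legPath_mem hp hq ht) hρ (norm_legPath_le hpρ hqρ ht) hs δ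
    fun j => q j - p j
  have h2 := sum_legPath_le hp hq he hr hr1 hpq ht
  have h3 : 0 < 1 - ρ := by linarith
  calc _ ≤ _ := h1
    _ ≤ 1 / (1 - ρ) * ((3 * n / r) / (t + e)) := by gcongr
    _ = _ := by ring

lemma norm_indexFun_le_of_term_le {p q : Fin n → ℂ} (hp : p ∈ polydisc n) (hq : q ∈ polydisc n)
    {e B : ℝ} (he : 0 < e) (hB : 0 ≤ B) {v : Fin n → ℕ} (hv : v ≠ 0)
    (hterm : ∀ s, v s ≠ 0 → ∀ δ, ∀ t ∈ Icc (0 : ℝ) 1,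
      ‖(indexFun p (indexStep v s δ) (legPath p q t) • indexForm v s δ (legPath p q t))
        fun j => q j - p j‖ ≤ B / (t + e)) {t : ℝ} (ht : t ∈ Icc (0 : ℝ) 1) :
    ‖indexFun p v (legPath p q t)‖ ≤ 2 * n * B * Real.log ((1 + e) / e) := by
  have h := norm_le_add_log (A := 0) (B := 2 * n * B) he
    (fun t ht => hasDerivAt_comp_legPath (hasFDerivAt_indexFun hp v (legPath_mem hp hq ht)))
    (by rw [legPath_zero, indexFun_base p hv, norm_zero]) (by positivity) (fun t ht => ?_) ht
  · rwa [zero_add] at h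
  · have hte : 0 < t + e := by linarith [ht.1]
    simp only [sum_apply]
    calc _ ≤ ∑ s ∈ support v, ∑ _δ : Fin 2, B / (t + e) :=
          norm_sum_le_of_le _ fun s hs => norm_sum_le_of_le _ fun δ _ =>
            hterm s (mem_support.1 hs) δ t ht
      _ ≤ ∑ s : Fin n, ∑ _δ : Fin 2, B / (t + e) :=
          Finset.sum_le_sum_of_subset_of_nonneg (Finset.subset_univ _) fun _ _ _ => by positivity
      _ = _ := by simp; ring

/-- The last coordinate stays fixed with modulus `e`, so weight one gains the factor `e` from
`norm_indexForm_last_le`. Every further weight costs a factor `Λ`, in which `2 n` counts the pairs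
of a position and a `δ`. -/
lemma norm_indexFun_legPath_le {p q : Fin n → ℂ} (hp : p ∈ polydisc n) (hq : q ∈ polydisc n)
    {e r ρ : ℝ} (he : 0 < e) (hr : 0 < r) (hr1 : r ≤ 1)
    (hpq : ∀ j, p j = q j ∨ (‖p j‖ = e ∧ r ≤ (q j).re)) (hρ : ρ < 1)
    (hpρ : ∀ j, ‖p j‖ ≤ ρ) (hqρ : ∀ j, ‖q j‖ ≤ ρ) {j₀ : Fin n} (hj₀ : ∀ s, s ≤ j₀)
    (hpe : ‖p j₀‖ = e) (hpj : q j₀ = p j₀) {C Λ : ℝ} (hC : C = 1 / (1 - ρ) * (3 * n / r))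
    (hΛ : Λ = 1 + 2 * n * C * Real.log ((1 + e) / e)) (K : ℕ) :
    ∀ v : Fin n → ℕ, ∑ i, v i = K + 1 → ∀ t ∈ Icc (0 : ℝ) 1,
      ‖indexFun p v (legPath p q t)‖ ≤ e * Λ ^ (K + 1) := by
  have hC0 : 0 ≤ C := by
    rw [hC]
    have : 0 < 1 - ρ := by linarith
    positivity
  have hL := log_ratio_nonneg he
  have hΛ1 : 1 ≤ Λ := by
    rw [hΛ]
    have : 0 ≤ 2 * n * C * Real.log ((1 + e) / e) := by positivity
    linarith
  induction K with
  | zero =>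
    intro v hv t ht
    have hterm : ∀ s, v s ≠ 0 → ∀ δ, ∀ t ∈ Icc (0 : ℝ) 1,
        ‖(indexFun p (indexStep v s δ) (legPath p q t) • indexForm v s δ (legPath p q t))
          fun j => q j - p j‖ ≤ e * C / (t + e) := by
      intro s hs δ t ht
      have h0 : indexStep v s δ = 0 := funext fun i =>
        Finset.sum_eq_zero_iff.1 (sum_indexStep hs hv δ) i (Finset.mem_univ i)
      rw [h0, indexFun_zero, one_smul]
      have hrest : ∑ i ∈ Finset.univ.erase s, v i + v s = 1 :=
        (Finset.sum_erase_add _ _ (Finset.mem_univ s)).trans hv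
      have hz : ∀ t, t ≠ s → v t = 0 := fun t ht =>
        Finset.sum_eq_zero_iff.1 (show ∑ i ∈ Finset.univ.erase s, v i = 0 by omega) t (by simp [ht])
      have h1 := norm_indexForm_last_le (legPath_mem hp hq ht) hρ (norm_legPath_le hpρ hqρ ht)
        (show v s = 1 by omega) (fun t ht => hz t ht.ne') δ (fun j => q j - p j) (hj₀ s)
      have h2 := sum_legPath_le hp hq he hr hr1 hpq ht
      have h3 : 0 < 1 - ρ := by linarith
      have h4 : legPath p q t j₀ = p j₀ := by simp [legPath, hpj]
      rw [h4, hpe] at h1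
      calc _ ≤ _ := h1
        _ ≤ e * (1 / (1 - ρ) * ((3 * n / r) / (t + e))) := by gcongr
        _ = _ := by rw [hC]; ring
    have hv0 : v ≠ 0 := by rintro rfl; simp at hv
    have h := norm_indexFun_le_of_term_le hp hq he (mul_nonneg he.le hC0) hv0 hterm ht
    refine h.trans ?_
    rw [zero_add, pow_one, hΛ]
    linarith
  | succ K ih =>
    intro v hv t ht
    have hΛ0 : 0 ≤ Λ := zero_le_one.trans hΛ1
    have hterm : ∀ s, v s ≠ 0 → ∀ δ, ∀ t ∈ Icc (0 : ℝ) 1,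
        ‖(indexFun p (indexStep v s δ) (legPath p q t) • indexForm v s δ (legPath p q t))
          fun j => q j - p j‖ ≤ e * Λ ^ (K + 1) * C / (t + e) := by
      intro s hs δ t ht
      have hte : 0 < t + e := by linarith [ht.1]
      have h1 := norm_indexForm_legPath_le hp hq he hr hr1 hpq hρ hpρ hqρ hs δ ht
      rw [← hC] at h1
      rw [smul_apply, norm_smul, mul_div_assoc]
      exact mul_le_mul (ih _ (sum_indexStep hs hv δ) t ht) h1 (norm_nonneg _) (by positivity)
    have hv0 : v ≠ 0 := by rintro rfl; simp at hv
    have h := norm_indexFun_le_of_term_le hp hq he (by positivity) hv0 hterm ht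
    refine h.trans ?_
    have h2 : 0 ≤ e * Λ ^ (K + 1) := by positivity
    calc _ = e * Λ ^ (K + 1) * (Λ - 1) := by rw [hΛ]; ring
      _ ≤ e * Λ ^ (K + 1) * Λ := by gcongr; linarith
      _ = _ := by ring

end FirstLeg

/-! ### Comparison with the series in the last variable -/

section SecondLeg
variable {n : ℕ} (X : ℕ → ℂ) (μ : ℕ → ℕ)

/-- The index `(μ₀, …, μ_{l-1}, k, 0, …, 0)`. -/
def truncIdx (n : ℕ) (μ : ℕ → ℕ) (l k : ℕ) : Fin n → ℕ := fun t =>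
  if t.val < l then μ t else if t.val = l then k else 0

lemma truncIdx_zero_zero : truncIdx n μ 0 0 = 0 := by
  funext t; simp [truncIdx]

lemma truncIdx_succ_zero (l : ℕ) : truncIdx n μ (l + 1) 0 = truncIdx n μ l (μ l) := by
  funext t
  simp only [truncIdx]
  split_ifs with h1 h2 h3 h4 <;> first | omega | rfl | simp_all

lemma indexStep_truncIdx (l k : ℕ) (hl : l < n) :
    indexStep (truncIdx n μ l (k + 1)) ⟨l, hl⟩ 0 = truncIdx n μ l k := by
  funext t
  simp only [indexStep, if_true, Pi.sub_apply, truncIdx]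
  rcases lt_trichotomy t.val l with h | h | h
  · have : t ≠ ⟨l, hl⟩ := fun hh => by simp [hh] at h
    simp [h, this]
  · have : t = ⟨l, hl⟩ := Fin.ext h
    simp [this]
  · have h1 : ¬t.val < l := by omega
    have h2 : t.val ≠ l := by omega
    simp [h1, h2]

/-- The multiple polylogarithm at the index `truncIdx n μ l k`, as a function of the last
variable. -/
def truncLi (n : ℕ) : ℕ → ℕ → (Fin n → ℂ) → ℂ
  | 0, 0 => fun _ => 1
  | l + 1, 0 => fun z => polyFun (truncSum (polyCoeff X μ) l) (μ l) (segProd n l n z)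
  | l, k + 1 => fun z => polyFun (truncSum (polyCoeff X μ) l) (k + 1) (segProd n l n z)

lemma truncLi_succ (l k : ℕ) (z : Fin n → ℂ) : truncLi X μ n l (k + 1) z
    = polyFun (truncSum (polyCoeff X μ) l) (k + 1) (segProd n l n z) := by
  cases l <;> rfl

lemma truncLi_of_one_le (l : ℕ) {k : ℕ} (hk : 1 ≤ k) (z : Fin n → ℂ) : truncLi X μ n l k z
    = polyFun (truncSum (polyCoeff X μ) l) k (segProd n l n z) := by
  obtain ⟨k, rfl⟩ := Nat.exists_eq_add_of_le' hk
  exact truncLi_succ X μ l k z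

variable {X μ} (hX : ∀ l, ‖X l‖ < 1) (hμ : ∀ l, 1 ≤ μ l)

-- Lowering the exponent `k + 1 ≥ 2` gives `dy / y`. At exponent 1 the Abel summation passes to
-- depth one less, and its argument `y X_l` is again a coordinate product because the earlier
-- coordinates are frozen at `X`.
include hX hμ in
lemma hasDerivAt_truncLi {p q : Fin n → ℂ} {t : ℝ} (hz : legPath p q t ∈ polydisc n) {l : ℕ}
    (hl : l < n) (hpX : ∀ j : Fin n, j.val < l → legPath p q t j = X j) (k : ℕ) :
    HasDerivAt (fun t => truncLi X μ n l (k + 1) (legPath p q t))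
      (truncLi X μ n l k (legPath p q t) * indexForm (truncIdx n μ l (k + 1)) ⟨l, hl⟩ 0
        (legPath p q t) fun j => q j - p j) t := by
  set y := segProd n l n (legPath p q t) with hy
  have hy1 : ‖y‖ < 1 := norm_segProd_lt_one hz hl hl
  have hy0 : y ≠ 0 := segProd_ne_zero hz l n
  have hyd := hasDerivAt_comp_legPath (p := p) (q := q)
    (differentiable_segProd (n := n) l n (legPath p q t)).hasFDerivAt
  obtain ⟨C, hC⟩ := norm_truncSum_le (summable_norm_polyCoeff hX μ) l
  have hs : truncIdx n μ l (k + 1) ⟨l, hl⟩ = k + 1 := by simp [truncIdx]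
  have hlast : ∀ t : Fin n, ⟨l, hl⟩ < t → truncIdx n μ l (k + 1) t = 0 := fun t ht => by
    have : l < t.val := ht
    simp [truncIdx, show ¬t.val < l by omega, show t.val ≠ l by omega]
  have hyc : yCoord (truncIdx n μ l (k + 1)) (rank (truncIdx n μ l (k + 1)) ⟨l, hl⟩)
      = segProd n l n := yCoord_last (by omega) hlast
  suffices ∃ c : ℂ, HasDerivAt (polyFun (truncSum (polyCoeff X μ) l) (k + 1)) c y ∧
      indexForm (truncIdx n μ l (k + 1)) ⟨l, hl⟩ 0 (legPath p q t) (fun j => q j - p j)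
        * truncLi X μ n l k (legPath p q t)
      = fderiv ℂ (segProd n l n) (legPath p q t) (fun j => q j - p j) * c by
    obtain ⟨c, hc, hc'⟩ := this
    simp only [truncLi_succ]
    rw [mul_comm, hc']
    have h := (hc.hasFDerivAt.restrictScalars ℝ).comp_hasDerivAt t hyd
    exact h.congr_deriv (by simp)
  rw [indexForm, formOf, hyc, hs]
  rcases k with _ | k
  · rw [if_neg (by omega), if_pos rfl]
    rcases l with _ | l
    · refine ⟨_, hasDerivAt_polyFun_truncSum_zero hX hy1, ?_⟩
      simp only [truncLi, smul_apply, smul_eq_mul, ← hy]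
      ring
    · refine ⟨_, hasDerivAt_polyFun_truncSum_succ hX hμ hy1 l, ?_⟩
      simp only [truncLi, smul_apply, smul_eq_mul, ← hy]
      rw [segProd_succ (show l < n by omega), hpX ⟨l, by omega⟩ (by simp), ← hy, mul_comm (X _) y]
      ring
  · rw [if_pos (by omega), if_pos rfl]
    refine ⟨_, hasDerivAt_polyFun_add_two hC hy1 hy0 k, ?_⟩
    simp only [truncLi_succ, smul_apply, smul_eq_mul, ← hy]
    ring

/-- At a position before `l` the form involves only frozen coordinates and vanishes on the velocity;
at `l`, the last nonzero position, the form with `δ = 1` is 0. A single term survives. -/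
lemma hasDerivAt_indexFun_truncIdx {P p q : Fin n → ℂ} (hP : P ∈ polydisc n) {t : ℝ}
    (hz : legPath p q t ∈ polydisc n) {l : ℕ} (hl : l < n)
    (hpq : ∀ j : Fin n, j.val + 1 < n → p j = q j) (k : ℕ) :
    HasDerivAt (fun t => indexFun P (truncIdx n μ l (k + 1)) (legPath p q t))
      (indexFun P (truncIdx n μ l k) (legPath p q t) *
        indexForm (truncIdx n μ l (k + 1)) ⟨l, hl⟩ 0 (legPath p q t) fun j => q j - p j) t := by
  set v := truncIdx n μ l (k + 1) with hv
  have hs : v ⟨l, hl⟩ = k + 1 := by simp [hv, truncIdx]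
  have hlast : ∀ t : Fin n, ⟨l, hl⟩ < t → v t = 0 := fun t ht => by
    have : l < t.val := ht
    simp [hv, truncIdx, show ¬t.val < l by omega, show t.val ≠ l by omega]
  refine (hasDerivAt_comp_legPath (hasFDerivAt_indexFun hP v hz)).congr_deriv ?_
  rw [sum_apply, Finset.sum_eq_single ⟨l, hl⟩]
  · rw [Fin.sum_univ_two, indexForm_last_one (by omega) hlast, smul_zero_form, add_zero,
      smul_apply, hv, indexStep_truncIdx, smul_eq_mul]
  · intro s hsv hsl
    have hvs := mem_support.1 hsv
    have hlt : s.val < l := by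
      by_contra hcon
      exact hvs (hlast s (lt_of_le_of_ne (not_lt.1 hcon) fun h => hsl h.symm))
    obtain ⟨r, hr, hy, hr2⟩ := exists_yCoord_eq hvs
    have hrl : r ≤ l := hr2 ⟨l, hl⟩ hlt (by omega)
    have h0 : fderiv ℂ (segProd n s r) (legPath p q t) (fun j => q j - p j) = 0 := by
      rw [fderiv_segProd hz, Finset.sum_eq_zero, mul_zero]
      intro α hα
      have hα' := (Finset.mem_filter_univ _).1 hα
      simp only [hpq α (by omega), sub_self, zero_div]
    rw [sum_apply]
    refine Finset.sum_eq_zero fun δ _ => ?_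
    rw [smul_apply, indexForm, formOf, hy]
    split_ifs <;> simp [h0]
  · intro h
    exact absurd (mem_support.2 (by omega)) h

/-- The term `N = 0` is a division by `0 ^ (k + 1)`, hence 0, so the series starts in degree one. -/
lemma norm_polyFun_le {e : ℕ → ℂ} {C : ℝ} (he : ∀ N, ‖e N‖ ≤ C) {w : ℂ} {ρ : ℝ} (hρ : ρ < 1)
    (hw : ‖w‖ ≤ ρ) (k : ℕ) : ‖polyFun e (k + 1) w‖ ≤ C / (1 - ρ) * ‖w‖ := by
  have hw1 : ‖w‖ < 1 := hw.trans_lt hρ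
  have hC0 : 0 ≤ C := (norm_nonneg _).trans (he 0)
  have h := summable_polyFun he hw1 (k + 1)
  rw [polyFun, h.tsum_eq_zero_add]
  simp only [CharP.cast_eq_zero, ne_eq, Nat.add_eq_zero_iff, one_ne_zero, and_false,
    not_false_eq_true, zero_pow, div_zero, zero_mul, zero_add]
  have hg := (hasSum_geometric_of_lt_one (norm_nonneg w) hw1).mul_right (‖w‖ * C)
  refine (tsum_of_norm_bounded hg fun N => ?_).trans ?_
  · refine (norm_polyFun_term_le he (k + 1) (N + 1)).trans (le_of_eq ?_)
    ring
  · have h1 : 0 < 1 - ρ := by linarith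
    have h2 : (1 - ‖w‖)⁻¹ ≤ (1 - ρ)⁻¹ := inv_anti₀ h1 (by linarith)
    calc _ ≤ (1 - ρ)⁻¹ * (‖w‖ * C) := by gcongr
      _ = _ := by ring

end SecondLeg

/-! ### Decay of `e` times powers of its logarithm -/

section Limit

lemma tendsto_mul_log_pow (c : ℝ) (hc : 0 ≤ c) (k : ℕ) :
    Tendsto (fun e : ℝ => e * (1 + c * Real.log ((1 + e) / e)) ^ k) (𝓝[>] 0) (𝓝 0) := by
  have hL : Tendsto (fun e : ℝ => Real.log ((1 + e) / e)) (𝓝[>] 0) atTop := by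
    refine Real.tendsto_log_atTop.comp ?_
    have h1 : Tendsto (fun e : ℝ => e⁻¹ + 1) (𝓝[>] 0) atTop :=
      tendsto_atTop_add_const_right _ _ tendsto_inv_nhdsGT_zero
    refine h1.congr' ?_
    filter_upwards [self_mem_nhdsWithin] with e he
    have : e ≠ 0 := ne_of_gt he
    field_simp
  have h2 := ((Real.tendsto_pow_mul_exp_neg_atTop_nhds_zero k).comp hL).const_mul (2 * (1 + c) ^ k)
  rw [mul_zero] at h2
  refine squeeze_zero' ?_ ?_ h2
  · filter_upwards [self_mem_nhdsWithin] with e he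
    have he' : 0 < e := he
    have := log_ratio_nonneg he'
    positivity
  · have h3 : ∀ᶠ e : ℝ in 𝓝[>] 0, e < 1 := nhdsWithin_le_nhds (gt_mem_nhds one_pos)
    filter_upwards [self_mem_nhdsWithin, h3, hL.eventually_ge_atTop 1] with e he he1 hL1
    have he' : 0 < e := he
    simp only [Function.comp]
    set L := Real.log ((1 + e) / e) with hLdef
    -- Here `exp (-L) = e / (1 + e)` and `e < 1`; the exponential then beats every power of `L`.
    have hexp : e ≤ 2 * Real.exp (-L) := by
      rw [Real.exp_neg, hLdef, Real.exp_log (by positivity), inv_div]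
      rw [mul_div_assoc', le_div_iff₀ (by linarith)]
      nlinarith
    have hpow : (1 + c * L) ^ k ≤ ((1 + c) * L) ^ k := by
      gcongr
      nlinarith
    calc e * (1 + c * L) ^ k ≤ (2 * Real.exp (-L)) * ((1 + c) * L) ^ k := by gcongr
      _ = _ := by rw [mul_pow]; ring

end Limit

/-! ### Error propagation along the second leg -/

section Comparison
variable {n : ℕ} {X : ℕ → ℂ} {μ : ℕ → ℕ} (hX : ∀ l, ‖X l‖ < 1) (hμ : ∀ l, 1 ≤ μ l)

lemma sum_truncIdx_succ {l k : ℕ} (hl : l < n) :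
    ∑ i, truncIdx n μ l (k + 1) i = ∑ i, truncIdx n μ l k i + 1 := by
  have h := sum_indexStep (v := truncIdx n μ l (k + 1)) (s := ⟨l, hl⟩) (by simp [truncIdx])
    (K := ∑ i, truncIdx n μ l (k + 1) i - 1) (Nat.sub_add_cancel ?_).symm 0
  · rw [indexStep_truncIdx] at h
    have : truncIdx n μ l (k + 1) ⟨l, hl⟩ ≤ ∑ i, truncIdx n μ l (k + 1) i :=
      Finset.single_le_sum (fun _ _ => Nat.zero_le _) (Finset.mem_univ _)
    simp only [truncIdx, lt_self_iff_false, if_false, if_true] at this h ⊢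
    omega
  · refine le_trans ?_ (Finset.single_le_sum (fun _ _ => Nat.zero_le _) (Finset.mem_univ ⟨l, hl⟩))
    simp [truncIdx]

include hX hμ in
/-- The series and the flat section agree up to a small error. -/
lemma norm_truncLi_sub_indexFun_le {P p q : Fin n → ℂ} (hP : P ∈ polydisc n)
    (hp : p ∈ polydisc n) (hq : q ∈ polydisc n)
    {e r ρ : ℝ} (he : 0 < e) (hr : 0 < r) (hr1 : r ≤ 1)
    (hpq : ∀ j, p j = q j ∨ (‖p j‖ = e ∧ r ≤ (q j).re)) (hρ : ρ < 1)
    (hpρ : ∀ j, ‖p j‖ ≤ ρ) (hqρ : ∀ j, ‖q j‖ ≤ ρ)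
    (hpq' : ∀ j : Fin n, j.val + 1 < n → p j = q j)
    (hqX : ∀ j : Fin n, j.val + 1 < n → q j = X j) {C Λ A : ℝ}
    (hC : C = 1 / (1 - ρ) * (3 * n / r))
    (hΛ : 1 + C * Real.log ((1 + e) / e) ≤ Λ)
    {N : ℕ}
    (hA : ∀ l k, l < n → ∑ i, truncIdx n μ l (k + 1) i ≤ N →
      ‖truncLi X μ n l (k + 1) p - indexFun P (truncIdx n μ l (k + 1)) p‖ ≤ A)
    (hA0 : 0 ≤ A) (l : ℕ) :
    l < n → ∀ k, ∑ i, truncIdx n μ l k i ≤ N → ∀ t ∈ Icc (0 : ℝ) 1,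
      ‖truncLi X μ n l k (legPath p q t) - indexFun P (truncIdx n μ l k) (legPath p q t)‖
        ≤ A * Λ ^ ∑ i, truncIdx n μ l k i := by
  have hC0 : 0 ≤ C := by
    rw [hC]
    have : 0 < 1 - ρ := by linarith
    positivity
  have hL := log_ratio_nonneg he
  have hΛ1 : 1 ≤ Λ := le_trans (le_add_of_nonneg_right (mul_nonneg hC0 hL)) hΛ
  have hΛ0 : 0 ≤ Λ := zero_le_one.trans hΛ1
  -- The derivative of the difference is the difference one weight lower times the common form, so
  -- the error grows at most by the factor `1 + C log ((1 + e) / e) ≤ Λ`.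
  have step : ∀ l, l < n → ∀ k, ∑ i, truncIdx n μ l (k + 1) i ≤ N →
      (∀ t ∈ Icc (0 : ℝ) 1,
        ‖truncLi X μ n l k (legPath p q t) - indexFun P (truncIdx n μ l k) (legPath p q t)‖
          ≤ A * Λ ^ ∑ i, truncIdx n μ l k i) →
      ∀ t ∈ Icc (0 : ℝ) 1,
        ‖truncLi X μ n l (k + 1) (legPath p q t)
          - indexFun P (truncIdx n μ l (k + 1)) (legPath p q t)‖
          ≤ A * Λ ^ ∑ i, truncIdx n μ l (k + 1) i := by
    intro l hl k hN ih t ht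
    rw [sum_truncIdx_succ hl]
    set w := ∑ i, truncIdx n μ l k i
    have hpX : ∀ t, ∀ j : Fin n, j.val < l → legPath p q t j = X j := fun t j hj => by
      simp [legPath, hpq' j (by omega), hqX j (by omega)]
    have h := norm_le_add_log (A := A) (B := A * Λ ^ w * C) he
      (fun t ht => (hasDerivAt_truncLi hX hμ (legPath_mem hp hq ht) hl (hpX t) k).sub
        (hasDerivAt_indexFun_truncIdx hP (legPath_mem hp hq ht) hl hpq' k))
      (by simpa using hA l k hl hN) (by positivity) (fun t ht => ?_) ht
    · have hw : 1 ≤ Λ ^ w := one_le_pow₀ hΛ1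
      refine h.trans ?_
      calc A + A * Λ ^ w * C * Real.log ((1 + e) / e)
          ≤ A * Λ ^ w + A * Λ ^ w * C * Real.log ((1 + e) / e) := by
            gcongr
            exact le_mul_of_one_le_right hA0 hw
        _ = A * Λ ^ w * (1 + C * Real.log ((1 + e) / e)) := by ring
        _ ≤ A * Λ ^ w * Λ := by gcongr
        _ = _ := by ring
    · have h1 := norm_indexForm_legPath_le hp hq he hr hr1 hpq hρ hpρ hqρ
        (v := truncIdx n μ l (k + 1)) (s := ⟨l, hl⟩) (by simp [truncIdx]) 0 ht
      rw [← hC] at h1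
      rw [← sub_mul, norm_mul, mul_div_assoc]
      exact mul_le_mul (ih t ht) h1 (norm_nonneg _) (by positivity)
  induction l with
  | zero =>
    intro hl k
    induction k with
    | zero =>
      intro _ t _
      rw [truncIdx_zero_zero, indexFun_zero, truncLi, sub_self, norm_zero]
      positivity
    | succ k ih =>
      exact fun hN => step 0 hl k hN (ih (by rw [sum_truncIdx_succ hl] at hN; omega))
  | succ l ihl =>
    intro hl k
    induction k with
    | zero =>
      intro hN t ht
      -- The exponent 0 at position `l + 1` is the full exponent `μ l` at position `l`.
      rw [truncIdx_succ_zero] at hN ⊢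
      have h := ihl (by omega) (μ l) hN t ht
      rwa [truncLi_of_one_le X μ l (hμ l)] at h
    | succ k ih =>
      exact fun hN => step (l + 1) hl k hN (ih (by rw [sum_truncIdx_succ hl] at hN; omega))

end Comparison

/-! ### The limit along the diagonal -/

section Main
variable {n : ℕ} {m : Fin (n + 1) → ℕ} {x : Fin (n + 1) → ℂ}

lemma Li_eq_truncLi (hx : ∀ i, ‖x i‖ < 1) {X : ℕ → ℂ} {μ : ℕ → ℕ} (hX : ∀ l, ‖X l‖ < 1)
    (hμ : ∀ l, 1 ≤ μ l) (hxX : ∀ i, x i = X i) (hmμ : ∀ i, m i = μ i) :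
    Li m x = truncLi X μ (n + 1) n (μ n) x := by
  rw [Li_eq_polyFun hx hX hμ hxX hmμ, truncLi_of_one_le X μ n (hμ n),
    segProd_succ (Nat.lt_succ_self n), hxX]
  have h : segProd (n + 1) (n + 1) (n + 1) x = 1 := by
    rw [segProd, Finset.filter_false_of_mem fun α _ => by omega, Finset.prod_empty]
  rw [h, mul_one]

lemma eq_truncIdx {μ : ℕ → ℕ} (hmμ : ∀ i, m i = μ i) : truncIdx (n + 1) μ n (μ n) = m := by
  funext t
  rw [truncIdx, hmμ]
  split_ifs with h1 h2
  · rfl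
  · rw [h2]
  · omega

/-- The two legs meet at `y`, which is `x` with last coordinate `ε`. There the series is `O(ε)` and
the solution is `O(ε Λ^K)`; the second leg multiplies their difference by at most `Λ^K`. This
explains the exponent `K + K`. -/
lemma exists_norm_Li_sub_indexFun_le (hm : ∀ i, 1 ≤ m i) (hx : x ∈ polydisc (n + 1)) :
    ∃ ρ > 0, ∃ c ≥ 0, ∃ D : ℝ, ∃ k : ℕ, ∀ ε : ℂ, diagPt (n + 1) ε ∈ polydisc (n + 1) → ‖ε‖ ≤ ρ →
      ‖indexFun (diagPt (n + 1) ε) m x - Li m x‖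
        ≤ D * (‖ε‖ * (1 + c * Real.log ((1 + ‖ε‖) / ‖ε‖)) ^ k) := by
  have hx1 : ∀ i, ‖x i‖ < 1 := norm_lt_one_of_mem_polydisc hx
  -- The default values 0 and 1 merely keep `‖X l‖ < 1` and `1 ≤ μ l` true for all `l`.
  let X : ℕ → ℂ := fun l => if h : l < n + 1 then x ⟨l, h⟩ else 0
  let μ : ℕ → ℕ := fun l => if h : l < n + 1 then m ⟨l, h⟩ else 1
  have hX : ∀ l, ‖X l‖ < 1 := fun l => by
    dsimp only [X]
    split_ifs
    · exact hx1 _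
    · simp
  have hμ : ∀ l, 1 ≤ μ l := fun l => by
    dsimp only [μ]
    split_ifs
    · exact hm _
    · exact le_rfl
  have hxX : ∀ i : Fin (n + 1), x i = X i := fun i => by
    dsimp only [X]
    rw [dif_pos i.2]
  have hmμ : ∀ i : Fin (n + 1), m i = μ i := fun i => by
    dsimp only [μ]
    rw [dif_pos i.2]
  obtain ⟨i₁, -, hi₁⟩ := Finset.exists_min_image Finset.univ (fun j => (x j).re)
    Finset.univ_nonempty
  obtain ⟨i₂, -, hi₂⟩ := Finset.exists_max_image Finset.univ (fun j => ‖x j‖)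
    Finset.univ_nonempty
  -- All constants below depend on `x` and `m` only, through these bounds on real parts and moduli,
  -- and not on `ε`.
  set r := (x i₁).re
  set ρ := ‖x i₂‖
  have hr : 0 < r := re_pos_of_mem_polydisc hx i₁
  have hr1 : r ≤ 1 := (Complex.re_le_norm _).trans (hx1 i₁).le
  have hxr : ∀ j, r ≤ (x j).re := fun j => hi₁ j (Finset.mem_univ j)
  have hxρ : ∀ j, ‖x j‖ ≤ ρ := fun j => hi₂ j (Finset.mem_univ j)
  have hρ : ρ < 1 := hx1 i₂
  have hρ1 : 0 < 1 - ρ := by linarith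
  choose B hB using norm_truncSum_le (summable_norm_polyCoeff hX μ)
  have hB0 : ∀ l, 0 ≤ B l := fun l => (norm_nonneg _).trans (hB l 0)
  set D := ∑ l ∈ Finset.range (n + 1), B l / (1 - ρ) with hD
  have hD0 : 0 ≤ D := Finset.sum_nonneg fun l _ => div_nonneg (hB0 l) hρ1.le
  have hBD : ∀ l < n + 1, B l / (1 - ρ) ≤ D := fun l hl =>
    Finset.single_le_sum (f := fun l => B l / (1 - ρ))
      (fun l _ => div_nonneg (hB0 l) hρ1.le) (Finset.mem_range.2 hl)
  set C := 1 / (1 - ρ) * (3 * ((n + 1 : ℕ) : ℝ) / r) with hC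
  have hC0 : 0 ≤ C := by positivity
  set K := ∑ i, m i with hK
  refine ⟨ρ, norm_pos_iff.2 (ne_zero_of_mem_polydisc hx i₂), 2 * ((n + 1 : ℕ) : ℝ) * C,
    by positivity, D + 1, K + K, fun ε hε hερ => ?_⟩
  set e := ‖ε‖
  have he : 0 < e := norm_pos_iff.2 (ne_zero_of_mem_polydisc hε 0)
  have hL := log_ratio_nonneg he
  set L := Real.log ((1 + e) / e)
  set Λ := 1 + 2 * ((n + 1 : ℕ) : ℝ) * C * L with hΛ
  have hΛ1 : 1 ≤ Λ := le_add_of_nonneg_right (by positivity)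
  have hΛC : 1 + C * L ≤ Λ := by
    have h : 0 ≤ C * L := mul_nonneg hC0 hL
    rw [hΛ]; push_cast
    nlinarith [mul_nonneg (Nat.cast_nonneg (α := ℝ) n) h]
  set y : Fin (n + 1) → ℂ := Function.update x (Fin.last n) ε with hy
  have hy_last : y (Fin.last n) = ε := by simp [hy]
  have hy_lt : ∀ j : Fin (n + 1), j.val + 1 < n + 1 → y j = x j := fun j hj => by
    have : j ≠ Fin.last n := fun h => by simp [h] at hj
    simp [hy, this]
  have hy_cases : ∀ j, j = Fin.last n ∨ y j = x j := fun j => by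
    by_cases h : j = Fin.last n
    · exact Or.inl h
    · exact Or.inr (by simp [hy, h])
  have hyD : y ∈ polydisc (n + 1) := fun j => by
    rcases hy_cases j with rfl | h
    · rw [hy_last]; exact hε 0
    · rw [h]; exact hx j
  have hyρ : ∀ j, ‖y j‖ ≤ ρ := fun j => by
    rcases hy_cases j with rfl | h
    · rwa [hy_last]
    · rw [h]; exact hxρ j
  have hleg₁ : ∀ v : Fin (n + 1) → ℕ, ∀ k, ∑ i, v i = k + 1 → k + 1 ≤ K →
      ‖indexFun (diagPt (n + 1) ε) v y‖ ≤ e * Λ ^ K := fun v k hv hk => by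
    have h := norm_indexFun_legPath_le hε hyD he hr hr1 (fun j => ?_) hρ (fun _ => hερ) hyρ
      (Fin.le_last) rfl hy_last hC hΛ k v hv 1 (right_mem_Icc.2 zero_le_one)
    · rw [legPath_one] at h
      exact h.trans (by gcongr)
    · rcases hy_cases j with rfl | h
      · exact Or.inl hy_last.symm
      · exact Or.inr ⟨rfl, h ▸ hxr j⟩
  have hA : ∀ l k, l < n + 1 → ∑ i, truncIdx (n + 1) μ l (k + 1) i ≤ K →
      ‖truncLi X μ (n + 1) l (k + 1) y
        - indexFun (diagPt (n + 1) ε) (truncIdx (n + 1) μ l (k + 1)) y‖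
        ≤ D * e + e * Λ ^ K := fun l k hl hlk => by
    refine (norm_sub_le _ _).trans (add_le_add ?_ ?_)
    · have hseg : ‖segProd (n + 1) l (n + 1) y‖ ≤ e := by
        have h := norm_segProd_le hρ hyρ (p := l) (q := n + 1) (j := Fin.last n)
          ⟨Nat.lt_succ_iff.1 hl, Nat.lt_succ_self n⟩
        rwa [hy_last] at h
      rw [truncLi_succ]
      exact (norm_polyFun_le (hB l) hρ (hseg.trans hερ) k).trans
        (mul_le_mul (hBD l hl) hseg (norm_nonneg _) hD0)
    · have hs := sum_truncIdx_succ (μ := μ) (k := k) hl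
      exact hleg₁ _ _ hs (hs ▸ hlk)
  have hKμ : ∑ i, truncIdx (n + 1) μ n (μ n) i = K := by rw [eq_truncIdx hmμ]
  have hmain := norm_truncLi_sub_indexFun_le hX hμ hε hyD hx he hr hr1
    (fun j => (hy_cases j).elim (fun h => Or.inr ⟨by rw [h, hy_last], hxr j⟩) Or.inl)
    hρ hyρ hxρ hy_lt (fun j _ => hxX j) hC hΛC hA (by positivity) n (Nat.lt_succ_self n) (μ n)
    hKμ.le 1 (right_mem_Icc.2 zero_le_one)
  rw [hKμ, legPath_one, eq_truncIdx hmμ, ← Li_eq_truncLi hx1 hX hμ hxX hmμ, norm_sub_rev] at hmain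
  refine hmain.trans ?_
  have hΛK : 1 ≤ Λ ^ K := one_le_pow₀ hΛ1
  calc (D * e + e * Λ ^ K) * Λ ^ K ≤ (D * e * Λ ^ K + e * Λ ^ K) * Λ ^ K := by
        have := le_mul_of_one_le_right (mul_nonneg hD0 he.le) hΛK
        gcongr
    _ = _ := by rw [pow_add]; ring

lemma tendsto_indexFun_diagPt (hm : ∀ i, 1 ≤ m i) (hx : x ∈ polydisc (n + 1)) :
    Tendsto (fun ε : ℂ => indexFun (diagPt (n + 1) ε) m x)
      (𝓝[{ε : ℂ | diagPt (n + 1) ε ∈ polydisc (n + 1)}] 0) (𝓝 (Li m x)) := by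
  obtain ⟨ρ, hρ, c, hc, D, k, h⟩ := exists_norm_Li_sub_indexFun_le hm hx
  rw [tendsto_iff_norm_sub_tendsto_zero]
  have hnorm : Tendsto (fun ε : ℂ => ‖ε‖) (𝓝[{ε : ℂ | diagPt (n + 1) ε ∈ polydisc (n + 1)}] 0)
      (𝓝[>] 0) := by
    refine tendsto_nhdsWithin_iff.2 ⟨tendsto_norm_zero.mono_left nhdsWithin_le_nhds, ?_⟩
    filter_upwards [self_mem_nhdsWithin] with ε hε
    exact norm_pos_iff.2 (ne_zero_of_mem_polydisc hε 0)
  have hlim := ((tendsto_mul_log_pow c hc k).comp hnorm).const_mul D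
  rw [mul_zero] at hlim
  refine squeeze_zero' (Eventually.of_forall fun _ => norm_nonneg _) ?_ hlim
  have hsmall : ∀ᶠ ε : ℂ in 𝓝[{ε : ℂ | diagPt (n + 1) ε ∈ polydisc (n + 1)}] 0, ‖ε‖ < ρ :=
    hnorm.eventually (nhdsWithin_le_nhds (gt_mem_nhds hρ))
  filter_upwards [self_mem_nhdsWithin, hsmall] with ε hε hερ
  exact h ε hε hερ.le

end Main

end MultiPolylog

end

/-! ### The proposition -/

theorem mainTheorem2 {n : ℕ} [NeZero n] (m : Fin n → ℕ) (hm : ∀ i, 1 ≤ m i)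
    (x : Fin n → ℂ) (hx : x ∈ MultiPolylog.polydisc n) :
    Summable (MultiPolylog.liTerm m x) ∧
    ∀ γ : ℂ → ℝ → Fin n → ℂ,
      (∀ ε : ℂ, MultiPolylog.diagPt n ε ∈ MultiPolylog.polydisc n →
        MultiPolylog.IsPathIn (MultiPolylog.polydisc n) (MultiPolylog.diagPt n ε) x (γ ε)) →
      Tendsto (fun ε : ℂ => MultiPolylog.polylogPathIntegral m (γ ε))
        (𝓝[{ε : ℂ | MultiPolylog.diagPt n ε ∈ MultiPolylog.polydisc n}] 0)
        (𝓝 (MultiPolylog.Li m x)) := by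
  refine ⟨MultiPolylog.summable_liTerm (MultiPolylog.norm_lt_one_of_mem_polydisc hx) m,
    fun γ hγ => ?_⟩
  obtain ⟨n, rfl⟩ := Nat.exists_eq_succ_of_ne_zero (NeZero.ne n)
  -- For every admissible `ε` the path integral equals the flat section exactly, so the choice of
  -- paths does not affect the limit.
  refine (MultiPolylog.tendsto_indexFun_diagPt hm hx).congr' ?_
  filter_upwards [self_mem_nhdsWithin] with ε hε
  obtain ⟨hpw, h0, h1, hD⟩ := hγ ε hε
  rw [MultiPolylog.polylogPathIntegral_eq hpw hD, h0, h1]
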